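/- Let $\mathbb{H}^3_1=\{(z^1,z^2)\in\mathbb{C}^2 : |z^1|^2-|z^2|^2=1\}$, identified with the Lie group $SU(1,1)$ through $(z^1,z^2)\mapsto\begin{pmatrix} z^1&z^2\\ \bar z^2&\bar z^1\end{pmatrix}$. Let $X_0,X_1,X_2$ be the left-invariant vector fields given by the matrices $\begin{pmatrix} i&0\\0&-i\end{pmatrix}$, $\begin{pmatrix}0&1\\1&0\end{pmatrix}$, $\begin{pmatrix}0&i\\-i&0\end{pmatrix}$, let $\theta^0,\theta^1,\theta^2$ be the dual coframe, and for real $\lambda\neq0$, $\mu>0$, $\nu>0$ let $g=g_{\lambda\mu\nu}=\lambda\,\theta^0\otimes\theta^0+\mu\,\theta^1\otimes\theta^1+\nu\,\theta^2\otimes\theta^2$, with Levi-Civita connection $\nabla$ and curvature $R$. A homogeneous structure on $(\mathbb{H}^3_1,g)$ is a smooth $(1,2)$-tensor field $S$ such that $\widetilde\nabla=\nabla-S$ satisfies $\widetilde\nabla g=0$, $\widetilde\nabla R=0$, $\widetilde\nabla S=0$; it is identified with the $(0,3)$-tensor $S(X,Y,Z)=g(S_XY,Z)$. Assume that $-\lambda\neq\mu$,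 $\mu\neq\nu$ and $\nu\neq-\lambda$. Then $g$ is a pseudo-Riemannian metric, it has a Levi-Civita connection, and: (1) The only homogeneous structure on $(\mathbb{H}^3_1,g)$ is $$S_0=-(\lambda-\mu+\nu)\,\theta^2\otimes\theta^0\wedge\theta^1+(\lambda+\mu+\nu)\,\theta^0\otimes\theta^1\wedge\theta^2-(\lambda+\mu-\nu)\,\theta^1\otimes\theta^2\wedge\theta^0,$$ where $\alpha\wedge\beta=\alpha\otimes\beta-\beta\otimes\alpha$ (that is, $S_0$ is a homogeneous structure and there is no other). (2) The canonical connection $\widetilde\nabla=\nabla-S_0$ satisfies $\widetilde\nabla X_\alpha=0$ for $\alpha=0,1,2$, and its curvature vanishes. (3) The left action of $SU(1,1)$ on $\mathbb{H}^3_1$ by matrix multiplication is smooth, transitive, effective and by isometries of $g$. At $o=(1,0)$ the isotropy group is trivial, and the reductive decomposition $\mathfrak g=\mathfrak h\oplus\mathfrak m$ of $\mathfrak g=\mathfrak{su}(1,1)$ is the trivial one, $\mathfrak h=0$, $\mathfrak m=\mathfrak g$. For $X\in\mathfrak g$ let $X^*$ be the vector field generated by $s\mapsto\exp(sX)$. Then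 $\widetilde\nabla$ is the canonical connection of this reductive decomposition: it is $SU(1,1)$-invariant and $\widetilde\nabla_{X^*}Y^*|_o=-[X,Y]^*|_o$ for all $X,Y\in\mathfrak g$. Conversely, $X\mapsto X^*|_o$ is a linear isomorphism of $\mathfrak g$ onto $T_o\mathbb{H}^3_1$ that carries the Lie bracket of $\mathfrak{su}(1,1)$ to the bracket $(x,y)\mapsto (S_0)_xy-(S_0)_yx$ defined by $S_0$. -/

import Mathlib

open scoped Manifold ContDiff ComplexConjugate

noncomputable section

/-- The hypersurface `ℍ³₁ = {(z¹, z²) ∈ ℂ² : |z¹|² - |z²|² = 1}`. -/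
@[ext]
structure H31 where
  /-- The complex coordinate `z¹`. -/
  z1 : ℂ
  /-- The complex coordinate `z²`. -/
  z2 : ℂ
  norm_eq : ‖z1‖ ^ 2 - ‖z2‖ ^ 2 = 1

/-- The Hermitian form of signature `(1, 1)`. -/
def hermJ : Matrix (Fin 2) (Fin 2) ℂ := !![1, 0; 0, -1]

/-- The matrix group `SU(1,1) = {A ∈ SL(2, ℂ) : A* J A = J}`. -/
def SU11 : Subgroup (Matrix.SpecialLinearGroup (Fin 2) ℂ) where
  carrier := {A | (A : Matrix (Fin 2) (Fin 2) ℂ).conjTranspose * hermJ *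
    (A : Matrix (Fin 2) (Fin 2) ℂ) = hermJ}
  one_mem' := by simp
  mul_mem' := by
    intro A B hA hB
    simp only [Set.mem_ofPred_eq, Matrix.SpecialLinearGroup.coe_mul,
      Matrix.conjTranspose_mul] at *
    calc _ = (B : Matrix (Fin 2) (Fin 2) ℂ).conjTranspose *
          ((A : Matrix (Fin 2) (Fin 2) ℂ).conjTranspose * hermJ *
            (A : Matrix (Fin 2) (Fin 2) ℂ)) * (B : Matrix (Fin 2) (Fin 2) ℂ) := by
          simp only [Matrix.mul_assoc]
      _ = _ := by rw [hA, hB]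
  inv_mem' := by
    intro A hA
    simp only [Set.mem_ofPred_eq] at *
    have h : (A : Matrix (Fin 2) (Fin 2) ℂ) *
        ((A⁻¹ : Matrix.SpecialLinearGroup (Fin 2) ℂ) : Matrix (Fin 2) (Fin 2) ℂ) = 1 := by
      rw [← Matrix.SpecialLinearGroup.coe_mul]; simp
    have h' := congrArg Matrix.conjTranspose h
    rw [Matrix.conjTranspose_mul, Matrix.conjTranspose_one] at h'
    calc _ = ((A⁻¹ : Matrix.SpecialLinearGroup (Fin 2) ℂ) :
            Matrix (Fin 2) (Fin 2) ℂ).conjTranspose *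
          ((A : Matrix (Fin 2) (Fin 2) ℂ).conjTranspose * hermJ *
            (A : Matrix (Fin 2) (Fin 2) ℂ)) *
          ((A⁻¹ : Matrix.SpecialLinearGroup (Fin 2) ℂ) : Matrix (Fin 2) (Fin 2) ℂ) := by rw [hA]
      _ = (((A⁻¹ : Matrix.SpecialLinearGroup (Fin 2) ℂ) :
            Matrix (Fin 2) (Fin 2) ℂ).conjTranspose *
          (A : Matrix (Fin 2) (Fin 2) ℂ).conjTranspose) * hermJ *
            ((A : Matrix (Fin 2) (Fin 2) ℂ) *
          ((A⁻¹ : Matrix.SpecialLinearGroup (Fin 2) ℂ) : Matrix (Fin 2) (Fin 2) ℂ)) := by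
          simp only [Matrix.mul_assoc]
      _ = _ := by rw [h, h']; simp

namespace H31

/-- The inclusion into `ℂ²`. -/
def incl (p : H31) : ℂ × ℂ := (p.z1, p.z2)

/-- The subspace topology of `ℂ²`. -/
instance : TopologicalSpace H31 := TopologicalSpace.induced incl inferInstance

theorem isInducing_incl : Topology.IsInducing incl := ⟨rfl⟩

theorem continuous_incl : Continuous incl := isInducing_incl.continuous

theorem conj_eq (p : H31) : p.z1 * conj p.z1 - p.z2 * conj p.z2 = 1 := by
  have h := p.norm_eq
  rw [Complex.mul_conj', Complex.mul_conj']
  exact_mod_cast h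

theorem continuous_z1 : Continuous z1 := continuous_fst.comp continuous_incl

theorem continuous_z2 : Continuous z2 := continuous_snd.comp continuous_incl

theorem of_conj {a b : ℂ} (h : a * conj a - b * conj b = 1) : ‖a‖ ^ 2 - ‖b‖ ^ 2 = 1 := by
  rw [Complex.mul_conj', Complex.mul_conj'] at h
  exact_mod_cast h

end H31

namespace SU11

theorem entries (A : SU11) : A.1.1 1 0 = conj (A.1.1 0 1) ∧ A.1.1 1 1 = conj (A.1.1 0 0) := by
  have h : A.1.1.conjTranspose * hermJ * A.1.1 = hermJ := A.2
  have hd : A.1.1.det = 1 := A.1.2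
  rw [Matrix.det_fin_two] at hd
  have h00 := congrFun (congrFun h 0) 0
  have h01 := congrFun (congrFun h 0) 1
  have h10 := congrFun (congrFun h 1) 0
  have h11 := congrFun (congrFun h 1) 1
  simp [hermJ, Matrix.mul_apply, Fin.sum_univ_two, Matrix.conjTranspose_apply] at h00 h01 h10 h11
  constructor
  · linear_combination A.1.1 1 0 * h11 - A.1.1 1 1 * h10 + conj (A.1.1 0 1) * hd
  · linear_combination -A.1.1 1 1 * h00 + A.1.1 1 0 * h01 + conj (A.1.1 0 0) * hd

theorem conj_eq (A : SU11) :
    A.1.1 0 0 * conj (A.1.1 0 0) - A.1.1 0 1 * conj (A.1.1 0 1) = 1 := by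
  have hd : A.1.1.det = 1 := A.1.2
  rw [Matrix.det_fin_two, (entries A).1, (entries A).2] at hd
  exact hd

end SU11

namespace H31

/-- The identification `(z¹, z²) ↦ !![z¹, z²; conj z², conj z¹]` of `ℍ³₁` with `SU(1,1)`. -/
def equivSU11 : H31 ≃ SU11 where
  toFun p := ⟨⟨!![p.z1, p.z2; conj p.z2, conj p.z1], by
    rw [Matrix.det_fin_two_of, ← p.conj_eq]⟩, by
    have h := p.conj_eq
    change Matrix.conjTranspose !![p.z1, p.z2; conj p.z2, conj p.z1] * hermJ *
      !![p.z1, p.z2; conj p.z2, conj p.z1] = hermJ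
    ext i j
    fin_cases i <;> fin_cases j <;>
      simp [hermJ, Matrix.mul_apply, Fin.sum_univ_two, Matrix.conjTranspose_apply]
    · linear_combination h
    · ring
    · ring
    · linear_combination -h⟩
  invFun A := ⟨A.1.1 0 0, A.1.1 0 1, of_conj (SU11.conj_eq A)⟩
  left_inv p := rfl
  right_inv A := by
    apply Subtype.ext
    apply Subtype.ext
    ext i j
    fin_cases i <;> fin_cases j
    · rfl
    · rfl
    · exact (SU11.entries A).1.symm
    · exact (SU11.entries A).2.symm

/-- The group structure of `ℍ³₁` is that of `SU(1,1)`, through the identification `equivSU11`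
(see `mulEquivSU11`): products are products of matrices. -/
instance : Group H31 where
  mul p q := ⟨p.z1 * q.z1 + p.z2 * conj q.z2, p.z1 * q.z2 + p.z2 * conj q.z1, of_conj (by
    simp only [map_add, map_mul, Complex.conj_conj]
    linear_combination (p.conj_eq) * (q.z1 * conj q.z1 - q.z2 * conj q.z2) + q.conj_eq)⟩
  one := ⟨1, 0, by simp⟩
  inv p := ⟨conj p.z1, -p.z2, by rw [Complex.norm_conj, norm_neg, p.norm_eq]⟩
  mul_assoc p q r := by
    apply H31.ext
    · change (p.z1 * q.z1 + p.z2 * conj q.z2) * r.z1 +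
        (p.z1 * q.z2 + p.z2 * conj q.z1) * conj r.z2 =
        p.z1 * (q.z1 * r.z1 + q.z2 * conj r.z2) + p.z2 * conj (q.z1 * r.z2 + q.z2 * conj r.z1)
      simp only [map_add, map_mul, Complex.conj_conj]
      ring
    · change (p.z1 * q.z1 + p.z2 * conj q.z2) * r.z2 +
        (p.z1 * q.z2 + p.z2 * conj q.z1) * conj r.z1 =
        p.z1 * (q.z1 * r.z2 + q.z2 * conj r.z1) + p.z2 * conj (q.z1 * r.z1 + q.z2 * conj r.z2)
      simp only [map_add, map_mul, Complex.conj_conj]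
      ring
  one_mul p := by
    apply H31.ext
    · change 1 * p.z1 + 0 * conj p.z2 = p.z1
      ring
    · change 1 * p.z2 + 0 * conj p.z1 = p.z2
      ring
  mul_one p := by
    apply H31.ext
    · change p.z1 * 1 + p.z2 * conj 0 = p.z1
      simp
    · change p.z1 * 0 + p.z2 * conj 1 = p.z2
      simp
  inv_mul_cancel p := by
    apply H31.ext
    · change conj p.z1 * p.z1 + -p.z2 * conj p.z2 = 1
      linear_combination p.conj_eq
    · change conj p.z1 * p.z2 + -p.z2 * conj p.z1 = 0
      ring

theorem mul_z1 (p q : H31) : (p * q).z1 = p.z1 * q.z1 + p.z2 * conj q.z2 := rfl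

theorem mul_z2 (p q : H31) : (p * q).z2 = p.z1 * q.z2 + p.z2 * conj q.z1 := rfl

theorem one_z1 : (1 : H31).z1 = 1 := rfl

theorem one_z2 : (1 : H31).z2 = 0 := rfl

theorem inv_z1 (p : H31) : (p⁻¹).z1 = conj p.z1 := rfl

theorem inv_z2 (p : H31) : (p⁻¹).z2 = -p.z2 := rfl

/-- The identification of `ℍ³₁` with `SU(1,1)`, as an isomorphism of groups. -/
def mulEquivSU11 : H31 ≃* SU11 where
  toEquiv := equivSU11
  map_mul' p q := by
    apply equivSU11.symm.injective
    apply H31.ext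
    · change (p * q).z1 = (!![p.z1, p.z2; conj p.z2, conj p.z1] *
        !![q.z1, q.z2; conj q.z2, conj q.z1]) 0 0
      simp [Matrix.mul_apply, Fin.sum_univ_two, mul_z1]
    · change (p * q).z2 = (!![p.z1, p.z2; conj p.z2, conj p.z1] *
        !![q.z1, q.z2; conj q.z2, conj q.z1]) 0 1
      simp [Matrix.mul_apply, Fin.sum_univ_two, mul_z2]

/-! ### The smooth structure: `ℍ³₁` as a hypersurface, by graph charts -/

/-- The model space of `ℍ³₁`. -/
abbrev Model : Type := ℝ × ℂ

theorem z1_ne (p : H31) : p.z1 ≠ 0 := by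
  intro h
  have := p.norm_eq
  rw [h, norm_zero] at this
  nlinarith [sq_nonneg ‖p.z2‖]

/-- The phase `z¹ / |z¹|`. -/
def phase (p : H31) : Circle :=
  ⟨p.z1 / (‖p.z1‖ : ℂ), by
    rw [Submonoid.unitSphere, ← SetLike.mem_coe]
    change _ ∈ Metric.sphere (0 : ℂ) 1
    rw [mem_sphere_zero_iff_norm, norm_div, Complex.norm_real, norm_norm,
      div_self (norm_ne_zero_iff.2 p.z1_ne)]⟩

/-- The domain of the coordinates `(s, w)` in the graph charts. -/
def chartTarget : Set Model := {y | y.1 ^ 2 < 1 + ‖y.2‖ ^ 2}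

/-- The first coordinate as a graph over the chart domain. -/
def graphZ1 (u : Circle) (y : Model) : ℂ :=
  (u : ℂ) * ((Real.sqrt (1 + ‖y.2‖ ^ 2 - y.1 ^ 2) : ℝ) + (y.1 : ℂ) * Complex.I)

theorem graph_mem (u : Circle) {y : Model} (hy : y ∈ chartTarget) :
    ‖graphZ1 u y‖ ^ 2 - ‖y.2‖ ^ 2 = 1 := by
  have h : 0 ≤ 1 + ‖y.2‖ ^ 2 - y.1 ^ 2 := by
    have : y.1 ^ 2 < 1 + ‖y.2‖ ^ 2 := hy
    linarith
  rw [graphZ1, norm_mul, Circle.norm_coe, one_mul, ← Complex.normSq_eq_norm_sq,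
    Complex.normSq_add_mul_I, Real.sq_sqrt h]
  ring

open Classical in
/-- The inverse of the graph chart. -/
def chartInv (u : Circle) (y : Model) : H31 :=
  if hy : y ∈ chartTarget then ⟨graphZ1 u y, y.2, graph_mem u hy⟩ else 1

theorem chartInv_z1 (u : Circle) {y : Model} (hy : y ∈ chartTarget) :
    (chartInv u y).z1 = graphZ1 u y := by
  rw [chartInv, dif_pos hy]

theorem chartInv_z2 (u : Circle) {y : Model} (hy : y ∈ chartTarget) :
    (chartInv u y).z2 = y.2 := by
  rw [chartInv, dif_pos hy]

theorem conj_mul_graphZ1 (u : Circle) (y : Model) :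
    conj (u : ℂ) * graphZ1 u y =
      (Real.sqrt (1 + ‖y.2‖ ^ 2 - y.1 ^ 2) : ℝ) + (y.1 : ℂ) * Complex.I := by
  rw [graphZ1, ← mul_assoc, mul_comm (conj (u : ℂ)), Complex.mul_conj', Circle.norm_coe]
  simp

theorem continuous_graphZ1 (u : Circle) : Continuous (graphZ1 u) := by
  unfold graphZ1
  fun_prop

/-- On the open set where `Re (conj u * z¹) > 0`, the hypersurface is the graph of a smooth function
of the coordinates `(Im (conj u * z¹), z²)`. -/
def graphChart (u : Circle) : OpenPartialHomeomorph H31 Model where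
  toFun p := ((conj (u : ℂ) * p.z1).im, p.z2)
  invFun := chartInv u
  source := {p | 0 < (conj (u : ℂ) * p.z1).re}
  target := chartTarget
  map_source' p hp := by
    have hp' : 0 < (conj (u : ℂ) * p.z1).re := hp
    have h := p.norm_eq
    have h2 : ‖conj (u : ℂ) * p.z1‖ ^ 2 = ‖p.z1‖ ^ 2 := by
      rw [norm_mul, Complex.norm_conj, Circle.norm_coe, one_mul]
    rw [← Complex.normSq_eq_norm_sq, Complex.normSq_apply] at h2
    change _ ^ 2 < 1 + ‖p.z2‖ ^ 2
    nlinarith [mul_pos hp' hp']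
  map_target' y hy := by
    have hy' : y.1 ^ 2 < 1 + ‖y.2‖ ^ 2 := hy
    change 0 < (conj (u : ℂ) * (chartInv u y).z1).re
    rw [chartInv_z1 u hy, conj_mul_graphZ1]
    simpa using hy'
  left_inv' p hp := by
    have hp' : 0 < (conj (u : ℂ) * p.z1).re := hp
    have h := p.norm_eq
    have h2 : ‖conj (u : ℂ) * p.z1‖ ^ 2 = ‖p.z1‖ ^ 2 := by
      rw [norm_mul, Complex.norm_conj, Circle.norm_coe, one_mul]
    rw [← Complex.normSq_eq_norm_sq, Complex.normSq_apply] at h2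
    have hy : ((conj (u : ℂ) * p.z1).im, p.z2) ∈ chartTarget := by
      change _ ^ 2 < 1 + ‖p.z2‖ ^ 2
      nlinarith [mul_pos hp' hp']
    have hs : Real.sqrt (1 + ‖p.z2‖ ^ 2 - (conj (u : ℂ) * p.z1).im ^ 2) =
        (conj (u : ℂ) * p.z1).re := by
      rw [Real.sqrt_eq_iff_mul_self_eq_of_pos hp']
      nlinarith
    apply H31.ext
    · rw [chartInv_z1 u hy, graphZ1]
      dsimp only
      rw [hs, Complex.re_add_im, ← mul_assoc, Complex.mul_conj', Circle.norm_coe]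
      simp
    · rw [chartInv_z2 u hy]
  right_inv' y hy := by
    have e := chartInv_z1 u hy
    have e2 := chartInv_z2 u hy
    rw [e, e2, conj_mul_graphZ1]
    simp
  open_source := isOpen_lt continuous_const
    (Complex.continuous_re.comp (continuous_const.mul continuous_z1))
  open_target := isOpen_lt (by fun_prop) (by fun_prop)
  continuousOn_toFun := ((Complex.continuous_im.comp (continuous_const.mul continuous_z1)).prodMk
    continuous_z2).continuousOn
  continuousOn_invFun := by
    rw [isInducing_incl.continuousOn_iff]
    have : Continuous fun y : Model => (graphZ1 u y, y.2) :=
      (continuous_graphZ1 u).prodMk continuous_snd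
    refine this.continuousOn.congr fun y hy => ?_
    exact Prod.ext (chartInv_z1 u hy) (chartInv_z2 u hy)

instance : ChartedSpace Model H31 where
  atlas := Set.range graphChart
  chartAt p := graphChart p.phase
  mem_chart_source p := by
    have h : conj (p.phase : ℂ) * p.z1 = (‖p.z1‖ : ℝ) := by
      change conj (p.z1 / (‖p.z1‖ : ℂ)) * p.z1 = _
      have h0 : (‖p.z1‖ : ℂ) ≠ 0 := by exact_mod_cast norm_ne_zero_iff.2 p.z1_ne
      rw [map_div₀, Complex.conj_ofReal, div_mul_eq_mul_div, mul_comm, Complex.mul_conj']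
      field_simp
    change 0 < (conj (p.phase : ℂ) * p.z1).re
    rw [h, Complex.ofReal_re]
    exact norm_pos_iff.2 p.z1_ne
  chart_mem_atlas p := ⟨_, rfl⟩

theorem contDiffOn_graphZ1 (u : Circle) : ContDiffOn ℝ ω (graphZ1 u) chartTarget := by
  have h1 : ContDiffOn ℝ ω (fun y : Model => Real.sqrt (1 + ‖y.2‖ ^ 2 - y.1 ^ 2)) chartTarget := by
    intro y hy
    have hy' : y.1 ^ 2 < 1 + ‖y.2‖ ^ 2 := hy
    refine ContDiffAt.contDiffWithinAt (ContDiffAt.sqrt ?_ (by linarith))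
    exact ((contDiff_const.add ((contDiff_norm_sq ℝ).comp contDiff_snd)).sub
      (contDiff_fst.pow 2)).contDiffAt
  unfold graphZ1
  exact contDiffOn_const.mul ((Complex.ofRealCLM.contDiff.comp_contDiffOn h1).add
    ((Complex.ofRealCLM.contDiff.comp contDiff_fst).mul contDiff_const).contDiffOn)

/-- The graph chart as a linear function of the ambient coordinates. -/
def chartLin (u : Circle) (x : ℂ × ℂ) : Model := ((conj (u : ℂ) * x.1).im, x.2)

theorem contDiff_chartLin (u : Circle) : ContDiff ℝ ω (chartLin u) :=
  (Complex.imCLM.contDiff.comp (contDiff_const.mul contDiff_fst)).prodMk contDiff_snd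

theorem contDiffOn_incl_chartInv (u : Circle) :
    ContDiffOn ℝ ω (incl ∘ chartInv u) chartTarget := by
  refine ((contDiffOn_graphZ1 u).prodMk contDiff_snd.contDiffOn).congr fun y hy => ?_
  exact Prod.ext (chartInv_z1 u hy) (chartInv_z2 u hy)

instance : IsManifold 𝓘(ℝ, Model) ω H31 := by
  apply isManifold_of_contDiffOn
  rintro _ _ ⟨u, rfl⟩ ⟨v, rfl⟩
  have h : ContDiffOn ℝ ω (chartLin v ∘ (incl ∘ chartInv u)) chartTarget :=
    (contDiff_chartLin v).comp_contDiffOn (contDiffOn_incl_chartInv u)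
  refine h.mono ?_
  rintro y ⟨hy, -⟩
  exact hy.1

theorem contMDiff_incl : ContMDiff 𝓘(ℝ, Model) 𝓘(ℝ, ℂ × ℂ) ω incl := by
  rw [contMDiff_iff]
  refine ⟨continuous_incl, fun p y => ?_⟩
  refine (contDiffOn_incl_chartInv p.phase).mono ?_
  rintro x ⟨hx, -⟩
  have hx' : x ∈ (chartAt Model p).target := by simpa [extChartAt] using hx
  exact hx'

section

variable {E' : Type*} [NormedAddCommGroup E'] [NormedSpace ℝ E'] {H' : Type*} [TopologicalSpace H']
  {I' : ModelWithCorners ℝ E' H'} {N : Type*} [TopologicalSpace N] [ChartedSpace H' N]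

/-- A map into `ℍ³₁` is smooth as soon as it is smooth as a map into `ℂ²`. -/
theorem contMDiff_of_incl {n : ℕ∞ω} [IsManifold I' n N] {f : N → H31}
    (h : ContMDiff I' 𝓘(ℝ, ℂ × ℂ) n (incl ∘ f)) : ContMDiff I' 𝓘(ℝ, Model) n f := by
  rw [contMDiff_iff_target]
  refine ⟨isInducing_incl.continuous_iff.2 h.continuous, fun y => ?_⟩
  have := ((contDiff_chartLin y.phase).of_le le_top : ContDiff ℝ n _).contMDiff.comp h
  exact this.contMDiffOn

end

theorem contMDiff_z1 : ContMDiff 𝓘(ℝ, Model) 𝓘(ℝ, ℂ) ω z1 :=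
  contDiff_fst.contMDiff.comp contMDiff_incl

theorem contMDiff_z2 : ContMDiff 𝓘(ℝ, Model) 𝓘(ℝ, ℂ) ω z2 :=
  contDiff_snd.contMDiff.comp contMDiff_incl

instance instLieGroupTop : LieGroup 𝓘(ℝ, Model) ω H31 where
  contMDiff_mul := by
    apply contMDiff_of_incl
    have a1 := contMDiff_z1.comp (contMDiff_fst (I := 𝓘(ℝ, Model)) (J := 𝓘(ℝ, Model))
      (M := H31) (N := H31))
    have a2 := contMDiff_z2.comp (contMDiff_fst (I := 𝓘(ℝ, Model)) (J := 𝓘(ℝ, Model))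
      (M := H31) (N := H31))
    have b1 := contMDiff_z1.comp (contMDiff_snd (I := 𝓘(ℝ, Model)) (J := 𝓘(ℝ, Model))
      (M := H31) (N := H31))
    have b2 := contMDiff_z2.comp (contMDiff_snd (I := 𝓘(ℝ, Model)) (J := 𝓘(ℝ, Model))
      (M := H31) (N := H31))
    have key : ContDiff ℝ ω (fun x : (ℂ × ℂ) × (ℂ × ℂ) =>
        (x.1.1 * x.2.1 + x.1.2 * conj x.2.2, x.1.1 * x.2.2 + x.1.2 * conj x.2.1)) := by
      have c : ContDiff ℝ ω (fun z : ℂ => conj z) := Complex.conjCLE.contDiff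
      fun_prop
    have := key.contMDiff.comp ((a1.prodMk_space a2).prodMk_space (b1.prodMk_space b2))
    refine this.congr fun x => ?_
    exact Prod.ext (mul_z1 _ _) (mul_z2 _ _)
  contMDiff_inv := by
    apply contMDiff_of_incl
    have key : ContDiff ℝ ω (fun x : ℂ × ℂ => (conj x.1, -x.2)) := by
      have c : ContDiff ℝ ω (fun z : ℂ => conj z) := Complex.conjCLE.contDiff
      fun_prop
    refine (key.contMDiff.comp contMDiff_incl).congr fun x => ?_
    exact Prod.ext (inv_z1 _) (inv_z2 _)

instance (n : ℕ∞ω) : LieGroup 𝓘(ℝ, Model) n H31 := LieGroup.of_le le_top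

/-- The identification of `ℍ³₁` with `SU(1,1)`, as a homeomorphism. -/
def homeoSU11 : H31 ≃ₜ SU11 where
  toEquiv := equivSU11
  continuous_toFun := by
    refine Continuous.subtype_mk (Continuous.subtype_mk ?_ _) _
    have h1 := continuous_z1
    have h2 := continuous_z2
    refine continuous_matrix fun i j => ?_
    fin_cases i <;> fin_cases j
    · exact h1
    · exact h2
    · exact Complex.continuous_conj.comp h2
    · exact Complex.continuous_conj.comp h1
  continuous_invFun := by
    rw [isInducing_incl.continuous_iff]
    have h : Continuous fun A : SU11 => A.1.1 :=
      continuous_subtype_val.comp continuous_subtype_val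
    exact (h.matrix_elem 0 0).prodMk (h.matrix_elem 0 1)

end H31

namespace SU11

open H31

/-- The smooth structure of `SU(1,1)`, with the coordinates of `ℍ³₁`. -/
instance : ChartedSpace Model SU11 where
  atlas := {e | ∃ c ∈ atlas Model H31, e = homeoSU11.symm.toOpenPartialHomeomorph ≫ₕ c}
  chartAt A := homeoSU11.symm.toOpenPartialHomeomorph ≫ₕ chartAt Model (homeoSU11.symm A)
  mem_chart_source A := by simp
  chart_mem_atlas A := ⟨_, chart_mem_atlas _ _, rfl⟩

instance : IsManifold 𝓘(ℝ, Model) ω SU11 := by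
  apply isManifold_of_contDiffOn
  rintro _ _ ⟨_, ⟨u, rfl⟩, rfl⟩ ⟨_, ⟨v, rfl⟩, rfl⟩
  have h : ContDiffOn ℝ ω (chartLin v ∘ (incl ∘ chartInv u)) chartTarget :=
    (contDiff_chartLin v).comp_contDiffOn (contDiffOn_incl_chartInv u)
  refine (h.mono ?_).congr ?_
  · rintro y ⟨hy, -⟩
    exact hy.1.1
  · intro y hy
    rfl

end SU11

namespace H31

theorem contMDiff_mulEquiv : ContMDiff 𝓘(ℝ, Model) 𝓘(ℝ, Model) ω mulEquivSU11 := by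
  rw [contMDiff_iff_target]
  refine ⟨homeoSU11.continuous, fun y => ?_⟩
  have := (contDiff_chartLin (homeoSU11.symm y).phase).contMDiff.comp contMDiff_incl
  exact this.contMDiffOn

theorem contMDiff_mulEquiv_symm :
    ContMDiff 𝓘(ℝ, Model) 𝓘(ℝ, Model) ω mulEquivSU11.symm := by
  apply contMDiff_of_incl
  rw [contMDiff_iff]
  refine ⟨continuous_incl.comp homeoSU11.symm.continuous, fun p y => ?_⟩
  refine (contDiffOn_incl_chartInv (homeoSU11.symm p).phase).mono ?_
  rintro x ⟨hx, -⟩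
  have hx' : x ∈ (chartAt Model p).target := by simpa [extChartAt] using hx
  exact hx'.1

end H31

namespace SU11

open H31

instance instLieGroupTop : LieGroup 𝓘(ℝ, Model) ω SU11 where
  contMDiff_mul := by
    have h := contMDiff_mulEquiv.comp ((contMDiff_mul 𝓘(ℝ, Model) ω).comp
      ((contMDiff_mulEquiv_symm.comp contMDiff_fst).prodMk
        (contMDiff_mulEquiv_symm.comp contMDiff_snd) :
        ContMDiff (𝓘(ℝ, Model).prod 𝓘(ℝ, Model)) (𝓘(ℝ, Model).prod 𝓘(ℝ, Model)) ω
          (fun x : SU11 × SU11 => (mulEquivSU11.symm x.1, mulEquivSU11.symm x.2))))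
    refine h.congr fun x => ?_
    simp
  contMDiff_inv := by
    have h := contMDiff_mulEquiv.comp ((contMDiff_inv 𝓘(ℝ, Model) ω).comp contMDiff_mulEquiv_symm)
    refine h.congr fun x => ?_
    simp

instance (n : ℕ∞ω) : LieGroup 𝓘(ℝ, Model) n SU11 := LieGroup.of_le le_top

/-- The left action of `SU(1,1)` on `ℍ³₁`: matrix multiplication under the identification of `ℍ³₁`
with `SU(1,1)` (see `mulEquivSU11_smul`). -/
instance : MulAction SU11 H31 where
  smul A p := mulEquivSU11.symm A * p
  one_smul p := by
    change mulEquivSU11.symm 1 * p = p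
    rw [map_one, one_mul]
  mul_smul A B p := by
    change mulEquivSU11.symm (A * B) * p = mulEquivSU11.symm A * (mulEquivSU11.symm B * p)
    rw [map_mul, mul_assoc]

theorem mulEquivSU11_smul (A : SU11) (p : H31) : mulEquivSU11 (A • p) = A * mulEquivSU11 p := by
  change mulEquivSU11 (mulEquivSU11.symm A * p) = _
  rw [map_mul, MulEquiv.apply_symm_apply]

end SU11

/-! ### Pseudo-Riemannian geometry -/

section Geometry

variable {E : Type*} [NormedAddCommGroup E] [NormedSpace ℝ E] {H : Type*} [TopologicalSpace H]
  (I : ModelWithCorners ℝ E H) {M : Type*} [TopologicalSpace M] [ChartedSpace H M]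

/-- (Not necessarily smooth) vector fields on `M`. -/
abbrev VField (M : Type*) [TopologicalSpace M] [ChartedSpace H M] : Type _ :=
  ∀ p : M, TangentSpace I p

variable [IsManifold I ∞ M]

/-- Smooth vector fields. -/
def IsSmoothField (X : VField I M) : Prop :=
  ContMDiff I I.tangent ∞ (fun p => (⟨p, X p⟩ : TangentBundle I M))

/-- Fields of bilinear forms, i.e. tensor fields of type `(0,2)`. -/
abbrev Tensor02 (M : Type*) [TopologicalSpace M] [ChartedSpace H M] : Type _ :=
  ∀ p : M, TangentSpace I p →L[ℝ] TangentSpace I p →L[ℝ] ℝ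

/-- Tensor fields of type `(1,2)`; `S p v w` stands for `S_v w`. -/
abbrev Tensor12 (M : Type*) [TopologicalSpace M] [ChartedSpace H M] : Type _ :=
  ∀ p : M, TangentSpace I p →L[ℝ] TangentSpace I p →L[ℝ] TangentSpace I p

/-- Linear connections on the tangent bundle. -/
abbrev LinConnection (M : Type*) [TopologicalSpace M] [ChartedSpace H M] [IsManifold I ∞ M] :
    Type _ :=
  CovariantDerivative I E (fun p : M => TangentSpace I p)

variable {I}

/-- The function `g(X, Y)`. -/
def Tensor02.eval (g : Tensor02 I M) (X Y : VField I M) (p : M) : ℝ := g p (X p) (Y p)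

/-- The vector field `S_X Y`. -/
def Tensor12.eval (S : Tensor12 I M) (X Y : VField I M) : VField I M := fun p => S p (X p) (Y p)

/-- A `(0,2)`-tensor field is a (smooth) pseudo-Riemannian metric. -/
structure IsPseudoRiemannianMetric (g : Tensor02 I M) : Prop where
  symm : ∀ p v w, g p v w = g p w v
  nondegenerate : ∀ p v, (∀ w, g p v w = 0) → v = 0
  smooth : ∀ X Y, IsSmoothField I X → IsSmoothField I Y → ContMDiff I 𝓘(ℝ, ℝ) ∞ (g.eval X Y)

/-- Smoothness of a `(1,2)`-tensor field: it maps smooth vector fields to smooth vector fields. -/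
def Tensor12.IsSmooth (S : Tensor12 I M) : Prop :=
  ∀ X Y, IsSmoothField I X → IsSmoothField I Y → IsSmoothField I (S.eval X Y)

/-- The vector field `∇_X Y`. -/
def LinConnection.nabla (D : LinConnection I M) (X Y : VField I M) : VField I M :=
  fun p => D Y p (X p)

/-- The curvature `R(X, Y)Z = ∇_X ∇_Y Z - ∇_Y ∇_X Z - ∇_[X,Y] Z`. -/
def LinConnection.curvature (D : LinConnection I M) (X Y Z : VField I M) : VField I M :=
  D.nabla X (D.nabla Y Z) - D.nabla Y (D.nabla X Z) - D.nabla (VectorField.mlieBracket I X Y) Z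

/-- `∇g = 0`, i.e. `W(g(X, Y)) = g(∇_W X, Y) + g(X, ∇_W Y)`. -/
def LinConnection.ParallelMetric (D : LinConnection I M) (g : Tensor02 I M) : Prop :=
  ∀ W X Y : VField I M, IsSmoothField I W → IsSmoothField I X → IsSmoothField I Y →
    ∀ p, mvfderiv I (g.eval X Y) p (W p) =
      g.eval (D.nabla W X) Y p + g.eval X (D.nabla W Y) p

/-- `∇̃R = 0` for the connection `D' = ∇̃` and the curvature `R` of the connection `D`. -/
def LinConnection.ParallelCurvature (D' D : LinConnection I M) : Prop :=
  ∀ W X Y Z : VField I M, IsSmoothField I W → IsSmoothField I X → IsSmoothField I Y →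
    IsSmoothField I Z →
    D'.nabla W (D.curvature X Y Z) =
      D.curvature (D'.nabla W X) Y Z + D.curvature X (D'.nabla W Y) Z +
        D.curvature X Y (D'.nabla W Z)

/-- `∇S = 0` for a `(1,2)`-tensor field `S`. -/
def LinConnection.ParallelTensor (D : LinConnection I M) (S : Tensor12 I M) : Prop :=
  ∀ W X Y : VField I M, IsSmoothField I W → IsSmoothField I X → IsSmoothField I Y →
    D.nabla W (S.eval X Y) = S.eval (D.nabla W X) Y + S.eval X (D.nabla W Y)

/-- `D` is the Levi-Civita connection of `g`: it is metric and torsion-free. -/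
structure IsLeviCivita (g : Tensor02 I M) (D : LinConnection I M) : Prop where
  metric : D.ParallelMetric g
  torsion_free : ∀ X Y : VField I M, IsSmoothField I X → IsSmoothField I Y →
    D.nabla X Y - D.nabla Y X = VectorField.mlieBracket I X Y

/-- The canonical connection `∇̃ = ∇ - S`. -/
def LinConnection.canonical (D : LinConnection I M) (S : Tensor12 I M) : LinConnection I M :=
  D.addOneForm fun p => -(ContinuousLinearMap.flip (E := E) (F := E) (G := E) (S p))

theorem LinConnection.canonical_nabla (D : LinConnection I M) (S : Tensor12 I M)
    (X Y : VField I M) : (D.canonical S).nabla X Y = D.nabla X Y - S.eval X Y := by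
  funext p
  change D Y p (X p) + -(S p (X p) (Y p)) = D Y p (X p) - S p (X p) (Y p)
  abel

/-- `S` is a homogeneous pseudo-Riemannian structure on `(M, g)`, where `D` is the Levi-Civita
connection of `g`: a smooth `(1,2)`-tensor field such that `∇̃ = ∇ - S` satisfies
`∇̃g = 0`, `∇̃R = 0` and `∇̃S = 0`. -/
structure IsHomogeneousStructure (g : Tensor02 I M) (D : LinConnection I M) (S : Tensor12 I M) :
    Prop where
  smooth : S.IsSmooth
  metric : (D.canonical S).ParallelMetric g
  curvature : (D.canonical S).ParallelCurvature D
  tensor : (D.canonical S).ParallelTensor S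

/-! ### Homogeneous spaces -/

variable {EG : Type*} [NormedAddCommGroup EG] [NormedSpace ℝ EG] {HG : Type*} [TopologicalSpace HG]
  (J : ModelWithCorners ℝ EG HG) (G : Type*) [TopologicalSpace G] [ChartedSpace HG G] [Group G]
  [MulAction G M]

/-- The action of `G` on `M` is by isometries of `g`. -/
def ActsByIsometries (g : Tensor02 I M) : Prop :=
  ∀ (a : G) (p : M) (v w : TangentSpace I p),
    g (a • p) (mfderiv I I (fun q : M => a • q) p v) (mfderiv I I (fun q : M => a • q) p w) =
      g p v w

/-- The connection `D` is invariant under the action of `G`. -/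
def LinConnection.IsInvariant (D : LinConnection I M) : Prop :=
  ∀ (a : G) (X Y : VField I M), IsSmoothField I X → IsSmoothField I Y →
    VectorField.mpullback I I (fun q : M => a • q) (D.nabla X Y) =
      D.nabla (VectorField.mpullback I I (fun q : M => a • q) X)
        (VectorField.mpullback I I (fun q : M => a • q) Y)

variable (I) {G}

/-- The derivative at the neutral element of the orbit map `a ↦ a • p`. -/
def orbitDeriv (p : M) : GroupLieAlgebra J G →L[ℝ] TangentSpace I p :=
  mfderiv J I (fun a : G => a • p) 1

/-- The vector field `X*` on `M` generated by `X` in the Lie algebra of `G`: its value at `p` is the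
derivative at `s = 0` of `exp(sX) • p`. -/
def fundamentalField (X : GroupLieAlgebra J G) : VField I M := fun p => orbitDeriv I J p X

/-- The Lie algebra of the isotropy group at `o`. -/
def isotropyAlgebra (o : M) : Submodule ℝ (GroupLieAlgebra J G) :=
  LinearMap.ker (orbitDeriv I J (G := G) o).toLinearMap

/-- The adjoint action of the group element `a` on the Lie algebra. -/
def adjointMap (a : G) : GroupLieAlgebra J G →L[ℝ] GroupLieAlgebra J G :=
  mfderiv J J (fun b : G => a * b * a⁻¹) 1

/-- `𝔤 = 𝔥 ⊕ 𝔪` is a reductive decomposition for the base point `o`: `𝔥` is the Lie algebra of the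
isotropy group `K` at `o`, and the complement `𝔪` is `Ad|_K`-invariant. -/
structure IsReductiveDecomposition (o : M) (𝔥 𝔪 : Submodule ℝ (GroupLieAlgebra J G)) : Prop where
  isotropy : 𝔥 = isotropyAlgebra I J o
  isCompl : IsCompl 𝔥 𝔪
  adInvariant : ∀ a ∈ MulAction.stabilizer G o, ∀ X ∈ 𝔪, adjointMap J a X ∈ 𝔪

variable {I}

/-- `D` is the canonical connection of the reductive decomposition `𝔤 = 𝔥 ⊕ 𝔪` at `o`: it is
`G`-invariant and `∇̃_{X*} Y*|_o = -([X, Y]_𝔪)*|_o` for `X, Y ∈ 𝔪`. -/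
structure IsCanonicalConnection (D : LinConnection I M) (o : M)
    (𝔥 𝔪 : Submodule ℝ (GroupLieAlgebra J G)) : Prop where
  invariant : D.IsInvariant G
  value : ∀ X ∈ 𝔪, ∀ Y ∈ 𝔪, ∀ U ∈ 𝔥, ∀ V ∈ 𝔪, ⁅X, Y⁆ = U + V →
    D.nabla (fundamentalField I J X) (fundamentalField I J Y) o = -fundamentalField I J V o

end Geometry

/-! ### The metrics of Kaluza-Klein type on `ℍ³₁` -/

namespace H31

/-- The one-parameter subgroups `s ↦ exp(s X_α)` of `ℍ³₁ ≅ SU(1,1)` for the matrices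
`X₀ = !![i, 0; 0, -i]`, `X₁ = !![0, 1; 1, 0]`, `X₂ = !![0, i; -i, 0]`. -/
def oneParam (α : Fin 3) (s : ℝ) : H31 :=
  match α with
  | 0 => ⟨Complex.exp (s * Complex.I), 0, by simp [Complex.norm_exp]⟩
  | 1 => ⟨Real.cosh s, Real.sinh s, by
      rw [Complex.norm_real, Complex.norm_real, Real.norm_eq_abs, Real.norm_eq_abs, sq_abs, sq_abs,
        Real.cosh_sq_sub_sinh_sq]⟩
  | 2 => ⟨Real.cosh s, Complex.I * Real.sinh s, by
      rw [norm_mul, Complex.norm_I, one_mul, Complex.norm_real, Complex.norm_real,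
        Real.norm_eq_abs, Real.norm_eq_abs, sq_abs, sq_abs, Real.cosh_sq_sub_sinh_sq]⟩

/-- The vectors `X_α` of the Lie algebra. -/
def frameOne (α : Fin 3) : GroupLieAlgebra 𝓘(ℝ, Model) H31 :=
  mfderiv 𝓘(ℝ, ℝ) 𝓘(ℝ, Model) (fun s : ℝ => (oneParam α s)) 0 (1 : ℝ)

/-- The left-invariant vector fields `X_α`. -/
def frame (α : Fin 3) : VField 𝓘(ℝ, Model) H31 := mulInvariantVectorField (frameOne α)

/-- Functions on `ℍ³₁` whose differentials at the neutral element `(1, 0)` are the dual basis of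
`X₀, X₁, X₂`. -/
def coordFun (α : Fin 3) (p : H31) : ℝ :=
  match α with
  | 0 => p.z1.im
  | 1 => p.z2.re
  | 2 => p.z2.im

/-- The left-invariant coframe `θ^α` dual to the frame `X_α`. -/
def coframe (α : Fin 3) (p : H31) : TangentSpace 𝓘(ℝ, Model) p →L[ℝ] ℝ :=
  mvfderiv 𝓘(ℝ, Model) (fun q : H31 => coordFun α (p⁻¹ * q)) p

/-- The metric `λ θ⁰ ⊗ θ⁰ + μ θ¹ ⊗ θ¹ + ν θ² ⊗ θ²`. -/
def metric (l m n : ℝ) : Tensor02 𝓘(ℝ, Model) H31 := fun p =>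
  l • (coframe 0 p).smulRight (coframe 0 p) + m • (coframe 1 p).smulRight (coframe 1 p) +
    n • (coframe 2 p).smulRight (coframe 2 p)

/-- `(θ^α ∧ θ^β)(v, w)`. -/
def wedge (α β : Fin 3) (p : H31) (v w : TangentSpace 𝓘(ℝ, Model) p) : ℝ :=
  coframe α p v * coframe β p w - coframe α p w * coframe β p v

/-- The `(0,3)`-tensor field
`-(λ-μ+ν) θ² ⊗ θ⁰ ∧ θ¹ + (λ+μ+ν) θ⁰ ⊗ θ¹ ∧ θ² - (λ+μ-ν) θ¹ ⊗ θ² ∧ θ⁰`. -/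
def S0 (l m n : ℝ) (p : H31) (u v w : TangentSpace 𝓘(ℝ, Model) p) : ℝ :=
  -(l - m + n) * (coframe 2 p u * wedge 0 1 p v w) +
    (l + m + n) * (coframe 0 p u * wedge 1 2 p v w) -
    (l + m - n) * (coframe 1 p u * wedge 2 0 p v w)

end H31

/-! ### The coframe is dual to the frame -/

namespace H31

theorem oneParam_zero (α : Fin 3) : oneParam α 0 = 1 := by
  apply H31.ext <;> fin_cases α <;> simp [oneParam, one_z1, one_z2]

theorem contMDiff_oneParam (α : Fin 3) : ContMDiff 𝓘(ℝ, ℝ) 𝓘(ℝ, Model) ∞ (oneParam α) := by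
  apply contMDiff_of_incl
  rw [contMDiff_iff_contDiff]
  have c : ContDiff ℝ ∞ (fun s : ℝ => (s : ℂ)) := Complex.ofRealCLM.contDiff
  fin_cases α
  · have : ContDiff ℝ ∞ (fun s : ℝ => (Complex.exp (s * Complex.I), (0 : ℂ))) := by
      have e : ContDiff ℝ ∞ Complex.exp := Complex.contDiff_exp
      fun_prop
    exact this
  · have : ContDiff ℝ ∞ (fun s : ℝ => ((Real.cosh s : ℂ), (Real.sinh s : ℂ))) :=
      (c.comp Real.contDiff_cosh).prodMk (c.comp Real.contDiff_sinh)
    exact this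
  · have : ContDiff ℝ ∞ (fun s : ℝ => ((Real.cosh s : ℂ), Complex.I * (Real.sinh s : ℂ))) :=
      (c.comp Real.contDiff_cosh).prodMk (contDiff_const.mul (c.comp Real.contDiff_sinh))
    exact this

theorem contMDiff_coordFun (α : Fin 3) : ContMDiff 𝓘(ℝ, Model) 𝓘(ℝ, ℝ) ∞ (coordFun α) := by
  have h1 := contMDiff_z1.of_le (m := ∞) le_top
  have h2 := contMDiff_z2.of_le (m := ∞) le_top
  fin_cases α
  · exact Complex.imCLM.contDiff.contMDiff.comp h1
  · exact Complex.reCLM.contDiff.contMDiff.comp h2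
  · exact Complex.imCLM.contDiff.contMDiff.comp h2

set_option linter.unusedSimpArgs false in
theorem deriv_coord_oneParam (α β : Fin 3) :
    HasDerivAt (fun s : ℝ => coordFun α (oneParam β s)) (if α = β then 1 else 0) 0 := by
  have h0 : HasDerivAt (fun s : ℝ => Real.sin s) 1 0 := by
    simpa using Real.hasDerivAt_sin 0
  have h1 : HasDerivAt (fun s : ℝ => Real.sinh s) 1 0 := by
    simpa using Real.hasDerivAt_sinh 0
  have hz : HasDerivAt (fun _ : ℝ => (0 : ℝ)) 0 0 := hasDerivAt_const _ _
  fin_cases α <;> fin_cases β <;>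
    simp [coordFun, oneParam, Complex.exp_ofReal_mul_I_im, hz, h0, h1, ← Complex.ofReal_sinh]

theorem coframe_frame (α β : Fin 3) (p : H31) :
    coframe α p (frame β p) = if α = β then 1 else 0 := by
  have hI : (∞ : ℕ∞ω) ≠ 0 := by simp
  have d1 : HasMFDerivAt 𝓘(ℝ, ℝ) 𝓘(ℝ, Model) (oneParam β) 0
      (mfderiv 𝓘(ℝ, ℝ) 𝓘(ℝ, Model) (oneParam β) 0) :=
    ((contMDiff_oneParam β).mdifferentiable hI 0).hasMFDerivAt
  have d2 : HasMFDerivAt 𝓘(ℝ, Model) 𝓘(ℝ, Model) (fun q : H31 => p * q) (oneParam β 0)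
      (mfderiv 𝓘(ℝ, Model) 𝓘(ℝ, Model) (fun q : H31 => p * q) 1) := by
    rw [oneParam_zero]
    exact ((contMDiff_mul_left (I := 𝓘(ℝ, Model)) (n := ∞) (a := p)).mdifferentiable
      hI _).hasMFDerivAt
  have d3 : HasMFDerivAt 𝓘(ℝ, Model) 𝓘(ℝ, ℝ) (fun q : H31 => coordFun α (p⁻¹ * q))
      (p * oneParam β 0)
      (mfderiv 𝓘(ℝ, Model) 𝓘(ℝ, ℝ) (fun q : H31 => coordFun α (p⁻¹ * q)) p) := by
    rw [oneParam_zero, mul_one]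
    exact (((contMDiff_coordFun α).comp (contMDiff_mul_left (I := 𝓘(ℝ, Model)) (n := ∞)
      (a := p⁻¹))).mdifferentiable hI _).hasMFDerivAt
  have d := (d3.comp 0 (d2.comp 0 d1))
  have e : ((fun q : H31 => coordFun α (p⁻¹ * q)) ∘ (fun q : H31 => p * q) ∘ oneParam β) =
      fun s : ℝ => coordFun α (oneParam β s) := by
    funext s; simp
  rw [e] at d
  have d4 := (deriv_coord_oneParam α β).hasFDerivAt.hasMFDerivAt
  have t := DFunLike.congr_fun (hasMFDerivAt_unique d d4) (1 : ℝ)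
  have r : (ContinuousLinearMap.toSpanSingleton ℝ (if α = β then (1 : ℝ) else 0)) (1 : ℝ) =
      if α = β then 1 else 0 := by simp
  exact Eq.trans t r

end H31

end

/-! The left-invariant frame trivializes the tangent bundle, and everything is read in components.
Let `flat` be the connection for which the frame is parallel. It has zero curvature, and its torsion
is given by the structure constants of the Lie algebra. Every tensor field with constant components
is `flat`-parallel, in particular the metric. The Koszul formula produces a left-invariant tensor
field, `structTensor`, such that `flat + structTensor` is metric and torsion-free; lowering its last
index gives `S0` (`metric_structTensor`). Every Levi-Civita connection agrees with this one on
smooth fields (`IsLeviCivita.nabla`), so `∇ - S₀` is `flat` there. Its curvature therefore vanishes,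
the frame is parallel for it, and since the metric, the curvature and `S₀` have constant components,
`S₀` is a homogeneous structure.

For uniqueness, let `S` be a homogeneous structure and write `t = S - S₀` (`diffComp`), so that `∇ -
S = flat - t`. Metricity makes each endomorphism `t_δ` skew for the metric, which leaves three
independent entries. Since the curvature has constant components, its parallelism is the algebraic
condition that each `t_δ` annihilates it as a derivation (`diffComp_curvature`). In this frame the
condition multiplies each entry of `t_δ` by a difference of two curvature coefficients. Each
difference is a product of a factor excluded from vanishing by the hypotheses and one of the forms
`l + m + n`, `l + m - n`, `l - m + n`. At most one of these forms can vanish, so at least two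
entries of `t_δ` are zero. If one form does vanish, the last entry is killed by parallelism of `S`
itself (`diffComp_tensor`): a component of `S` on which `t` vanishes identically is constant, so its
derivative drops out and a linear equation for the missing entry remains.

For the group action, left translations preserve the coframe, hence the metric and `flat`. The orbit
map at the base point is the diffeomorphism from `SU(1,1)`, so the isotropy is trivial. A
fundamental field `Y*` has components `Ad(q⁻¹)Y` at `q`; differentiating at the neutral element
gives `-[X, Y]`. Torsion-freeness identifies the bracket with the antisymmetrization of `S₀`. -/

noncomputable section

/-! ### Derivatives of functions along vector fields, and the Lie bracket. -/

section Derivations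

variable {E : Type*} [NormedAddCommGroup E] [NormedSpace ℝ E] {H : Type*} [TopologicalSpace H]
  {I : ModelWithCorners ℝ E H} {M : Type*} [TopologicalSpace M] [ChartedSpace H M]
  [IsManifold I ∞ M] {F : Type*} [NormedAddCommGroup F] [NormedSpace ℝ F]

theorem ContMDiff.mvfderiv_field {f : M → F} (hf : ContMDiff I 𝓘(ℝ, F) ∞ f) {X : VField I M}
    (hX : IsSmoothField I X) : ContMDiff I 𝓘(ℝ, F) ∞ (fun p => mvfderiv I f p (X p)) := by
  have h1 : ContMDiff I.tangent 𝓘(ℝ, F).tangent ∞ (tangentMap I 𝓘(ℝ, F) f) :=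
    hf.contMDiff_tangentMap le_rfl
  have h2 := contMDiff_snd_tangentBundle_modelSpace F 𝓘(ℝ, F) (n := ∞)
  exact h2.comp (h1.comp hX)

/-- The pointwise version is needed because the axioms of a covariant derivative concern fields that
are only differentiable at the given point. -/
theorem ContMDiff.mdifferentiableAt_mvfderiv_field {f : M → F} (hf : ContMDiff I 𝓘(ℝ, F) ∞ f)
    {X : VField I M} {p : M}
    (hX : MDifferentiableAt I I.tangent (fun p => (⟨p, X p⟩ : TangentBundle I M)) p) :
    MDifferentiableAt I 𝓘(ℝ, F) (fun p => mvfderiv I f p (X p)) p := by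
  have h1 : ContMDiff I.tangent 𝓘(ℝ, F).tangent ∞ (tangentMap I 𝓘(ℝ, F) f) :=
    hf.contMDiff_tangentMap le_rfl
  have h2 := contMDiff_snd_tangentBundle_modelSpace F 𝓘(ℝ, F) (n := ∞)
  exact ((h2.comp h1).mdifferentiable (by simp) _).comp p hX

theorem IsSmoothField.mdifferentiableAt {X : VField I M} (hX : IsSmoothField I X) (p : M) :
    MDifferentiableAt I I.tangent (fun p => (⟨p, X p⟩ : TangentBundle I M)) p :=
  ContMDiff.mdifferentiable hX (by simp) p

theorem IsSmoothField.add {X Y : VField I M} (hX : IsSmoothField I X) (hY : IsSmoothField I Y) :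
    IsSmoothField I (X + Y) := ContMDiff.add_section hX hY

theorem IsSmoothField.sub {X Y : VField I M} (hX : IsSmoothField I X) (hY : IsSmoothField I Y) :
    IsSmoothField I (X - Y) := ContMDiff.sub_section hX hY

theorem IsSmoothField.smul {X : VField I M} (hX : IsSmoothField I X) {f : M → ℝ}
    (hf : ContMDiff I 𝓘(ℝ, ℝ) ∞ f) : IsSmoothField I (f • X) :=
  ContMDiff.smul_section hf hX

theorem IsSmoothField.mlieBracket [CompleteSpace E] {X Y : VField I M} (hX : IsSmoothField I X)
    (hY : IsSmoothField I Y) : IsSmoothField I (VectorField.mlieBracket I X Y) := by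
  have : IsManifold I ((⊤ : ℕ∞) + 1) M := by simpa using ‹IsManifold I ∞ M›
  have : IsManifold I (minSmoothness ℝ 2) M := by
    rw [minSmoothness_of_isRCLikeNormedField]
    exact IsManifold.of_le (n := ∞) ENat.LEInfty.out
  exact ContDiff.mlieBracket_vectorField (m := ⊤) (n := ⊤) hX hY (by simp)

/-- The Lie bracket of vector fields is the commutator of derivations, on functions and at points
where some smooth vector field does not vanish. -/
theorem mvfderiv_mlieBracket_of_ne_zero [CompleteSpace E] {X Y Z : VField I M}
    (hX : IsSmoothField I X) (hY : IsSmoothField I Y) (hZ : IsSmoothField I Z) {f : M → ℝ}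
    (hf : ContMDiff I 𝓘(ℝ, ℝ) ∞ f) {p : M} (hp : Z p ≠ 0) :
    mvfderiv I f p (VectorField.mlieBracket I X Y p) =
      mvfderiv I (fun q => mvfderiv I f q (Y q)) p (X p) -
        mvfderiv I (fun q => mvfderiv I f q (X q)) p (Y p) := by
  have : IsManifold I (minSmoothness ℝ 3) M := by
    rw [minSmoothness_of_isRCLikeNormedField]
    exact IsManifold.of_le (n := ∞) ENat.LEInfty.out
  have h2 : minSmoothness ℝ 2 ≤ ∞ := by
    rw [minSmoothness_of_isRCLikeNormedField]; exact ENat.LEInfty.out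
  -- The Jacobi identity for `X, Y, fZ` is compared with `f` times the one for `X, Y, Z`.
  -- First-order terms cancel, and what is left is `([X, Y]f - XYf + YXf) Z = 0` at `p`; a nonzero
  -- `Z p` then allows cancellation.
  have key : ∀ (U V : VField I M), IsSmoothField I U → IsSmoothField I V →
      VectorField.mlieBracket I U (VectorField.mlieBracket I V (f • Z)) p =
        mvfderiv I (fun q => mvfderiv I f q (V q)) p (U p) • Z p +
        mvfderiv I f p (V p) • VectorField.mlieBracket I U Z p +
        (mvfderiv I f p (U p) • VectorField.mlieBracket I V Z p +
        f p • VectorField.mlieBracket I U (VectorField.mlieBracket I V Z) p) := by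
    intro U V hU hV
    have e : VectorField.mlieBracket I V (f • Z) =
        (fun q => mvfderiv I f q (V q)) • Z + f • VectorField.mlieBracket I V Z := by
      funext q
      exact VectorField.mlieBracket_smul_right (hf.mdifferentiable (by simp) q)
        (hZ.mdifferentiableAt q)
    have hfV := hf.mvfderiv_field hV
    have hVZ := hV.mlieBracket hZ
    rw [e, VectorField.mlieBracket_add_right ((hZ.smul hfV).mdifferentiableAt p)
      ((hVZ.smul hf).mdifferentiableAt p),
      VectorField.mlieBracket_smul_right (hfV.mdifferentiable (by simp) p)
        (hZ.mdifferentiableAt p),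
      VectorField.mlieBracket_smul_right (hf.mdifferentiable (by simp) p)
        (hVZ.mdifferentiableAt p)]
  have j1 := VectorField.leibniz_identity_mlieBracket_apply (I := I) (x := p)
    ((ContMDiff.of_le hX h2) p) ((ContMDiff.of_le hY h2) p) ((ContMDiff.of_le (hZ.smul hf) h2) p)
  have j2 := VectorField.leibniz_identity_mlieBracket_apply (I := I) (x := p)
    ((ContMDiff.of_le hX h2) p) ((ContMDiff.of_le hY h2) p) ((ContMDiff.of_le hZ h2) p)
  change VectorField.mlieBracket I X (VectorField.mlieBracket I Y (f • Z)) p =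
    VectorField.mlieBracket I (VectorField.mlieBracket I X Y) (f • Z) p +
    VectorField.mlieBracket I Y (VectorField.mlieBracket I X (f • Z)) p at j1
  rw [key X Y hX hY, key Y X hY hX, VectorField.mlieBracket_smul_right
    (hf.mdifferentiable (by simp) p) (hZ.mdifferentiableAt p), j2] at j1
  have j3 : (mvfderiv I f p (VectorField.mlieBracket I X Y p) -
      (mvfderiv I (fun q => mvfderiv I f q (Y q)) p (X p) -
        mvfderiv I (fun q => mvfderiv I f q (X q)) p (Y p))) • Z p = 0 := by
    rw [← sub_eq_zero] at j1
    rw [← neg_eq_zero, ← j1]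
    module
  rcases smul_eq_zero.1 j3 with h | h
  · linarith
  · exact absurd h hp

end Derivations

/-! ### Smoothness of left-invariant vector fields. -/

section LieGroup

variable {E : Type*} [NormedAddCommGroup E] [NormedSpace ℝ E] {H : Type*} [TopologicalSpace H]
  {I : ModelWithCorners ℝ E H} {G : Type*} [TopologicalSpace G] [ChartedSpace H G] [Group G]
  [LieGroup I ∞ G]

/-- The field is the tangent map of multiplication applied to the zero vector at `g` and the fixed
vector `v` at the neutral element, a composite of smooth maps. -/
theorem isSmoothField_mulInvariantVectorField (v : GroupLieAlgebra I G) :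
    IsSmoothField I (mulInvariantVectorField v : VField I G) := by
  let w : TangentBundle I G := ⟨1, v⟩
  have s₁ : ContMDiff I (I.tangent.prod I.tangent) ∞
      (fun g : G => ((⟨g, 0⟩ : TangentBundle I G), w)) :=
    (Bundle.contMDiff_zeroSection ℝ (fun p : G => TangentSpace I p)).prodMk contMDiff_const
  have s₃ : ContMDiff (I.prod I).tangent I.tangent ∞
      (tangentMap (I.prod I) I (fun p : G × G => p.1 * p.2)) :=
    (contMDiff_mul I ∞).contMDiff_tangentMap le_rfl
  have s := (s₃.comp contMDiff_equivTangentBundleProd_symm).comp s₁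
  refine s.congr fun g => ?_
  refine Bundle.TotalSpace.ext (mul_one g).symm ?_
  have h := mfderiv_prod_eq_add_apply (I := I) (I' := I) (I'' := I) (p := (g, (1 : G)))
    (v := ((0 : E), (v : E)))
    (((contMDiff_mul I ∞).mdifferentiable (by simp) (g, (1 : G))))
  refine heq_of_eq (Eq.trans ?_ h.symm)
  have z : (mfderiv I I (fun z : G => z * 1) g) (0 : E) = (0 : E) := map_zero _
  exact (Eq.trans (congrArg (· + (mfderiv I I (fun z : G => g * z) 1 v : E)) z) (zero_add _)).symm

end LieGroup

/-! ### The frame as a basis, and components of vector fields. -/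

namespace H31

theorem isSmoothField_frame (α : Fin 3) : IsSmoothField 𝓘(ℝ, Model) (frame α) :=
  isSmoothField_mulInvariantVectorField _

theorem linearIndependent_frame (p : H31) :
    LinearIndependent ℝ (fun α => (frame α p : TangentSpace 𝓘(ℝ, Model) p)) := by
  rw [Fintype.linearIndependent_iff]
  intro c hc β
  have h := congrArg (coframe β p) hc
  simpa [map_sum, coframe_frame] using h

theorem finrank_model : Module.finrank ℝ Model = 3 := by
  rw [Module.finrank_prod, Complex.finrank_real_complex, Module.finrank_self]

theorem sum_coframe_smul_frame (p : H31) (v : TangentSpace 𝓘(ℝ, Model) p) :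
    ∑ α, coframe α p v • frame α p = v := by
  have : FiniteDimensional ℝ (TangentSpace 𝓘(ℝ, Model) p) :=
    inferInstanceAs (FiniteDimensional ℝ Model)
  have hs : Submodule.span ℝ (Set.range
      (fun α => (frame α p : TangentSpace 𝓘(ℝ, Model) p))) = ⊤ :=
    (linearIndependent_frame p).span_eq_top_of_card_eq_finrank' (by
      rw [Fintype.card_fin]; exact finrank_model.symm)
  have hv : v ∈ Submodule.span ℝ (Set.range
      (fun α => (frame α p : TangentSpace 𝓘(ℝ, Model) p))) := hs ▸ Submodule.mem_top
  obtain ⟨c, rfl⟩ := (Submodule.mem_span_range_iff_exists_fun ℝ).1 hv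
  congr 1
  funext β
  congr 1
  simp [map_sum, coframe_frame]

theorem ext_coframe {p : H31} {v w : TangentSpace 𝓘(ℝ, Model) p}
    (h : ∀ α, coframe α p v = coframe α p w) : v = w := by
  rw [← sum_coframe_smul_frame p v, ← sum_coframe_smul_frame p w]
  simp only [h]

/-- The linear functional `x ↦ u_α (a⁻¹ x)` on `ℂ²`. -/
def transCoord (α : Fin 3) (a : ℂ × ℂ) : ℂ × ℂ →L[ℝ] ℝ :=
  let fs := ContinuousLinearMap.fst ℝ ℂ ℂ
  let sn := ContinuousLinearMap.snd ℝ ℂ ℂ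
  let cj := Complex.conjCLE.toContinuousLinearMap
  match α with
  | 0 => Complex.imCLM ∘L (conj a.1 • fs - a.2 • cj ∘L sn)
  | 1 => Complex.reCLM ∘L (conj a.1 • sn - a.2 • cj ∘L fs)
  | 2 => Complex.imCLM ∘L (conj a.1 • sn - a.2 • cj ∘L fs)

theorem transCoord_incl (α : Fin 3) (p q : H31) :
    transCoord α (incl p) (incl q) = coordFun α (p⁻¹ * q) := by
  fin_cases α <;> simp [transCoord, coordFun, incl, mul_z1, mul_z2, inv_z1, inv_z2] <;> ring

theorem contDiff_transCoord (α : Fin 3) :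
    ContDiff ℝ ∞ (fun x : (ℂ × ℂ) × (ℂ × ℂ) => transCoord α x.1 x.2) := by
  have c : ContDiff ℝ ∞ (fun z : ℂ => conj z) := Complex.conjCLE.contDiff
  have re : ContDiff ℝ ∞ Complex.re := Complex.reCLM.contDiff
  have im : ContDiff ℝ ∞ Complex.im := Complex.imCLM.contDiff
  fin_cases α <;> simp only [transCoord]
  · have : ContDiff ℝ ∞ fun x : (ℂ × ℂ) × (ℂ × ℂ) =>
      (conj x.1.1 * x.2.1 - x.1.2 * conj x.2.2).im := by fun_prop
    exact this
  · have : ContDiff ℝ ∞ fun x : (ℂ × ℂ) × (ℂ × ℂ) =>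
      (conj x.1.1 * x.2.2 - x.1.2 * conj x.2.1).re := by fun_prop
    exact this
  · have : ContDiff ℝ ∞ fun x : (ℂ × ℂ) × (ℂ × ℂ) =>
      (conj x.1.1 * x.2.2 - x.1.2 * conj x.2.1).im := by fun_prop
    exact this

theorem smooth_incl : ContMDiff 𝓘(ℝ, Model) 𝓘(ℝ, ℂ × ℂ) ∞ incl := contMDiff_incl.of_le le_top

/-- The function defining the coframe is the restriction of a linear functional on `ℂ²` whose
coefficients depend smoothly on `p`. This makes the components of a smooth field smooth. -/
theorem coframe_eq (α : Fin 3) (p : H31) (v : TangentSpace 𝓘(ℝ, Model) p) :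
    coframe α p v = transCoord α (incl p) (mvfderiv 𝓘(ℝ, Model) incl p v) := by
  have e : (fun q : H31 => coordFun α (p⁻¹ * q)) = transCoord α (incl p) ∘ incl := by
    funext q
    exact (transCoord_incl α p q).symm
  have h := ((transCoord α (incl p)).hasFDerivAt (x := incl p)).hasMFDerivAt.comp p
    (smooth_incl.mdifferentiable (by simp) p).hasMFDerivAt
  rw [coframe, e]
  exact DFunLike.congr_fun h.mfderiv v

/-- The component `X^α` of a vector field. -/
def comp (α : Fin 3) (X : VField 𝓘(ℝ, Model) H31) (p : H31) : ℝ := coframe α p (X p)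

theorem contMDiff_comp (α : Fin 3) {X : VField 𝓘(ℝ, Model) H31}
    (hX : IsSmoothField 𝓘(ℝ, Model) X) : ContMDiff 𝓘(ℝ, Model) 𝓘(ℝ, ℝ) ∞ (comp α X) := by
  have h := (contDiff_transCoord α).contMDiff.comp
    (smooth_incl.prodMk_space (smooth_incl.mvfderiv_field hX))
  exact h.congr fun p => coframe_eq α p (X p)

theorem mdifferentiableAt_comp (α : Fin 3) {X : VField 𝓘(ℝ, Model) H31} {p : H31}
    (hX : MDifferentiableAt 𝓘(ℝ, Model) 𝓘(ℝ, Model).tangent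
      (fun p => (⟨p, X p⟩ : TangentBundle 𝓘(ℝ, Model) H31)) p) :
    MDifferentiableAt 𝓘(ℝ, Model) 𝓘(ℝ, ℝ) (comp α X) p := by
  have h := ((contDiff_transCoord α).contMDiff.mdifferentiable (by simp) _).comp p
    ((smooth_incl.mdifferentiable (by simp) p).prodMk_space
      (smooth_incl.mdifferentiableAt_mvfderiv_field hX))
  have e : comp α X = (fun x : (ℂ × ℂ) × (ℂ × ℂ) => transCoord α x.1 x.2) ∘
      fun q => (incl q, mvfderiv 𝓘(ℝ, Model) incl q (X q)) := by
    funext q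
    exact coframe_eq α q (X q)
  rw [e]
  exact h

theorem eq_sum_comp_smul_frame (X : VField 𝓘(ℝ, Model) H31) :
    X = ∑ α, comp α X • frame α := by
  funext p
  rw [Finset.sum_apply]
  exact (sum_coframe_smul_frame p (X p)).symm

theorem isSmoothField_of_comp {X : VField 𝓘(ℝ, Model) H31}
    (h : ∀ α, ContMDiff 𝓘(ℝ, Model) 𝓘(ℝ, ℝ) ∞ (comp α X)) : IsSmoothField 𝓘(ℝ, Model) X := by
  rw [eq_sum_comp_smul_frame X, Fin.sum_univ_three]
  exact (((isSmoothField_frame 0).smul (h 0)).add ((isSmoothField_frame 1).smul (h 1))).add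
    ((isSmoothField_frame 2).smul (h 2))

theorem comp_frame (α β : Fin 3) : comp α (frame β) = fun _ => if α = β then 1 else 0 := by
  funext p
  exact coframe_frame α β p

theorem comp_ext {X Y : VField 𝓘(ℝ, Model) H31} (h : ∀ α, comp α X = comp α Y) : X = Y := by
  rw [eq_sum_comp_smul_frame X, eq_sum_comp_smul_frame Y]
  simp only [h]

/-! ### Derivatives along the frame and the structure constants. -/

theorem hasDerivAt_frame {f : H31 → ℝ} {p : H31}
    (hf : MDifferentiableAt 𝓘(ℝ, Model) 𝓘(ℝ, ℝ) f p) (α : Fin 3) :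
    HasDerivAt (fun s => f (p * oneParam α s)) (mvfderiv 𝓘(ℝ, Model) f p (frame α p)) 0 := by
  have hI : (∞ : ℕ∞ω) ≠ 0 := by simp
  have d1 : HasMFDerivAt 𝓘(ℝ, ℝ) 𝓘(ℝ, Model) (oneParam α) 0
      (mfderiv 𝓘(ℝ, ℝ) 𝓘(ℝ, Model) (oneParam α) 0) :=
    ((contMDiff_oneParam α).mdifferentiable hI 0).hasMFDerivAt
  have d2 : HasMFDerivAt 𝓘(ℝ, Model) 𝓘(ℝ, Model) (fun q : H31 => p * q) (oneParam α 0)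
      (mfderiv 𝓘(ℝ, Model) 𝓘(ℝ, Model) (fun q : H31 => p * q) 1) := by
    rw [oneParam_zero]
    exact ((contMDiff_mul_left (I := 𝓘(ℝ, Model)) (n := ∞) (a := p)).mdifferentiable
      hI _).hasMFDerivAt
  have d3 : HasMFDerivAt 𝓘(ℝ, Model) 𝓘(ℝ, ℝ) f (p * oneParam α 0)
      (mfderiv 𝓘(ℝ, Model) 𝓘(ℝ, ℝ) f p) := by
    rw [oneParam_zero, mul_one]
    exact hf.hasMFDerivAt
  -- The value of `L` at `1` unfolds to the derivative of `f` on the left translate of `frameOne α`,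
  -- that is, on `frame α p`.
  let L : ℝ →L[ℝ] ℝ := (mfderiv 𝓘(ℝ, Model) 𝓘(ℝ, ℝ) f p).comp
    ((mfderiv 𝓘(ℝ, Model) 𝓘(ℝ, Model) (fun q : H31 => p * q) 1).comp
      (mfderiv 𝓘(ℝ, ℝ) 𝓘(ℝ, Model) (oneParam α) 0))
  have d : HasFDerivAt (fun s : ℝ => f (p * oneParam α s)) L 0 :=
    (d3.comp 0 (d2.comp 0 d1)).hasFDerivAt
  exact d.hasDerivAt

theorem mvfderiv_eq_sum (f : H31 → ℝ) (p : H31) (v : TangentSpace 𝓘(ℝ, Model) p) :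
    mvfderiv 𝓘(ℝ, Model) f p v =
      ∑ α, coframe α p v * mvfderiv 𝓘(ℝ, Model) f p (frame α p) := by
  conv_lhs => rw [← sum_coframe_smul_frame p v]
  simp [map_sum]

/-- The Lie bracket of vector fields on `ℍ³₁` is the commutator of derivations. -/
theorem mvfderiv_mlieBracket {X Y : VField 𝓘(ℝ, Model) H31}
    (hX : IsSmoothField 𝓘(ℝ, Model) X) (hY : IsSmoothField 𝓘(ℝ, Model) Y) {f : H31 → ℝ}
    (hf : ContMDiff 𝓘(ℝ, Model) 𝓘(ℝ, ℝ) ∞ f) (p : H31) :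
    mvfderiv 𝓘(ℝ, Model) f p (VectorField.mlieBracket 𝓘(ℝ, Model) X Y p) =
      mvfderiv 𝓘(ℝ, Model) (fun q => mvfderiv 𝓘(ℝ, Model) f q (Y q)) p (X p) -
        mvfderiv 𝓘(ℝ, Model) (fun q => mvfderiv 𝓘(ℝ, Model) f q (X q)) p (Y p) :=
  mvfderiv_mlieBracket_of_ne_zero hX hY (isSmoothField_frame 0) hf
    ((linearIndependent_frame p).ne_zero 0)

/-- The matrices `X_α`, through their first rows. -/
def frameVec (α : Fin 3) : ℂ × ℂ :=
  match α with
  | 0 => (Complex.I, 0)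
  | 1 => (0, 1)
  | 2 => (0, Complex.I)

theorem hasDerivAt_incl_oneParam (α : Fin 3) :
    HasDerivAt (fun s => incl (oneParam α s)) (frameVec α) 0 := by
  have hz : ∀ c : ℂ, HasDerivAt (fun _ : ℝ => c) 0 0 := fun c => hasDerivAt_const _ _
  have hc : HasDerivAt (fun s : ℝ => (Real.cosh s : ℂ)) 0 0 := by
    simpa using (Real.hasDerivAt_cosh 0).ofReal_comp
  have hs : HasDerivAt (fun s : ℝ => (Real.sinh s : ℂ)) 1 0 := by
    simpa using (Real.hasDerivAt_sinh 0).ofReal_comp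
  fin_cases α
  · have he : HasDerivAt (fun s : ℝ => Complex.exp (s * Complex.I)) Complex.I 0 := by
      have h := ((hasDerivAt_id (0 : ℝ)).ofReal_comp.mul_const Complex.I).cexp
      simpa using h
    exact he.prodMk (hz 0)
  · exact hc.prodMk hs
  · have := hs.const_mul Complex.I
    rw [mul_one] at this
    exact hc.prodMk this

theorem hasDerivAt_coordFun_mul_oneParam (γ : Fin 3) (r : H31) (β : Fin 3) :
    HasDerivAt (fun s => coordFun γ (r * oneParam β s))
      (transCoord γ (incl r⁻¹) (frameVec β)) 0 := by
  have h := (transCoord γ (incl r⁻¹)).hasFDerivAt.comp_hasDerivAt 0 (hasDerivAt_incl_oneParam β)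
  refine h.congr_of_eventuallyEq (.of_forall fun s => ?_)
  simp [transCoord_incl]

/-- The linear functional `x ↦ u_γ (x w)` on `ℂ²`. -/
def transCoordLeft (γ : Fin 3) (w : ℂ × ℂ) : ℂ × ℂ →L[ℝ] ℝ :=
  LinearMap.toContinuousLinearMap
    { toFun := fun x => transCoord γ (conj x.1, -x.2) w
      map_add' := fun x y => by
        fin_cases γ <;> simp [transCoord] <;> ring
      map_smul' := fun c x => by
        fin_cases γ <;> simp [transCoord] <;> ring }

theorem transCoordLeft_apply (γ : Fin 3) (w x : ℂ × ℂ) :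
    transCoordLeft γ w x = transCoord γ (conj x.1, -x.2) w := rfl

theorem contMDiff_transCoordLeft (γ : Fin 3) (w : ℂ × ℂ) (p : H31) :
    ContMDiff 𝓘(ℝ, Model) 𝓘(ℝ, ℝ) ∞ (fun q : H31 => transCoordLeft γ w (incl (p⁻¹ * q))) :=
  (transCoordLeft γ w).contDiff.contMDiff.comp (smooth_incl.comp contMDiff_mul_left)

theorem contMDiff_coordFun_mul_left (γ : Fin 3) (p : H31) :
    ContMDiff 𝓘(ℝ, Model) 𝓘(ℝ, ℝ) ∞ (fun q : H31 => coordFun γ (p⁻¹ * q)) :=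
  (contMDiff_coordFun γ).comp contMDiff_mul_left

/-- The curve `p⁻¹ q exp(sX_β)` has velocity `(p⁻¹ q) X_β` as a matrix product. The result is again
linear in the entries of `p⁻¹ q`, so it can be differentiated once more. -/
theorem mvfderiv_coordFun_frame (γ β : Fin 3) (p q : H31) :
    mvfderiv 𝓘(ℝ, Model) (fun q : H31 => coordFun γ (p⁻¹ * q)) q (frame β q) =
      transCoordLeft γ (frameVec β) (incl (p⁻¹ * q)) := by
  have h := hasDerivAt_frame ((contMDiff_coordFun_mul_left γ p).mdifferentiable (by simp) q) β
  refine h.unique ?_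
  have h' := hasDerivAt_coordFun_mul_oneParam γ (p⁻¹ * q) β
  simp only [mul_assoc] at h'
  exact h'

theorem mvfderiv_transCoordLeft_frame (γ : Fin 3) (w : ℂ × ℂ) (α : Fin 3) (p : H31) :
    mvfderiv 𝓘(ℝ, Model) (fun q : H31 => transCoordLeft γ w (incl (p⁻¹ * q))) p (frame α p) =
      transCoordLeft γ w (frameVec α) := by
  have h := hasDerivAt_frame ((contMDiff_transCoordLeft γ w p).mdifferentiable (by simp) p) α
  refine h.unique ?_
  have h' := (transCoordLeft γ w).hasFDerivAt.comp_hasDerivAt 0 (hasDerivAt_incl_oneParam α)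
  refine h'.congr_of_eventuallyEq (.of_forall fun s => ?_)
  simp

/-- The structure constants of the frame: `[X_α, X_β] = ∑ γ, bracketCoeff α β γ X_γ`. -/
def bracketCoeff : Fin 3 → Fin 3 → Fin 3 → ℝ :=
  ![![![0, 0, 0], ![0, 0, 2], ![0, -2, 0]],
    ![![0, 0, -2], ![0, 0, 0], ![-2, 0, 0]],
    ![![0, 2, 0], ![2, 0, 0], ![0, 0, 0]]]

theorem bracketCoeff_antisymm (α β γ : Fin 3) : bracketCoeff α β γ = -bracketCoeff β α γ := by
  fin_cases α <;> fin_cases β <;> fin_cases γ <;> simp [bracketCoeff]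

/-- The two terms are the `γ` coordinates of the matrix products `X_α X_β` and `X_β X_α`, so the
difference is that of the matrix commutator. -/
theorem transCoordLeft_frameVec_sub (α β γ : Fin 3) :
    transCoordLeft γ (frameVec β) (frameVec α) - transCoordLeft γ (frameVec α) (frameVec β) =
      bracketCoeff α β γ := by
  fin_cases α <;> fin_cases β <;> fin_cases γ <;>
    norm_num [bracketCoeff, transCoordLeft_apply, transCoord, frameVec]

theorem mvfderiv_sum_mul {f g : Fin 3 → H31 → ℝ} {p : H31}
    (hf : ∀ β, MDifferentiableAt 𝓘(ℝ, Model) 𝓘(ℝ, ℝ) (f β) p)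
    (hg : ∀ β, MDifferentiableAt 𝓘(ℝ, Model) 𝓘(ℝ, ℝ) (g β) p) (v : TangentSpace 𝓘(ℝ, Model) p) :
    mvfderiv 𝓘(ℝ, Model) (fun q => ∑ β, f β q * g β q) p v =
      ∑ β, (f β p * mvfderiv 𝓘(ℝ, Model) (g β) p v +
        mvfderiv 𝓘(ℝ, Model) (f β) p v * g β p) := by
  have e : (fun q => ∑ β, f β q * g β q) = f 0 * g 0 + f 1 * g 1 + f 2 * g 2 := by
    funext q
    simp [Fin.sum_univ_three]
  have d := fun β => (hf β).mul (hg β)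
  rw [e, mvfderiv_add ((d 0).add (d 1)) (d 2), mvfderiv_add (d 0) (d 1),
    mvfderiv_mul (hf 0) (hg 0), mvfderiv_mul (hf 1) (hg 1), mvfderiv_mul (hf 2) (hg 2)]
  simp only [add_apply, smul_apply, smul_eq_mul,
    Fin.sum_univ_three]
  ring

/-- By the product rule on `Y = ∑ Y^β X_β`: at `q = p` the first derivatives of the coordinate are
the Kronecker delta, which isolates `Y^γ`, and its second derivatives along the frame are the
coordinates of `X_α X_β`. -/
theorem mvfderiv_mvfderiv_coordFun {Y : VField 𝓘(ℝ, Model) H31}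
    (hY : IsSmoothField 𝓘(ℝ, Model) Y) (γ : Fin 3) (p : H31) (v : TangentSpace 𝓘(ℝ, Model) p) :
    mvfderiv 𝓘(ℝ, Model) (fun q => mvfderiv 𝓘(ℝ, Model)
        (fun q : H31 => coordFun γ (p⁻¹ * q)) q (Y q)) p v =
      mvfderiv 𝓘(ℝ, Model) (comp γ Y) p v + ∑ α, ∑ β,
        transCoordLeft γ (frameVec β) (frameVec α) * (coframe α p v * comp β Y p) := by
  have e : (fun q => mvfderiv 𝓘(ℝ, Model) (fun q : H31 => coordFun γ (p⁻¹ * q)) q (Y q)) =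
      fun q => ∑ β, comp β Y q * transCoordLeft γ (frameVec β) (incl (p⁻¹ * q)) := by
    funext q
    rw [mvfderiv_eq_sum]
    simp only [mvfderiv_coordFun_frame, comp]
  have d1 := fun β => (contMDiff_comp β hY).mdifferentiable (by simp) p
  have d2 := fun β => (contMDiff_transCoordLeft γ (frameVec β) p).mdifferentiable (by simp) p
  have h1 : ∀ β, transCoordLeft γ (frameVec β) (incl (p⁻¹ * p)) = if γ = β then 1 else 0 := by
    intro β
    rw [← mvfderiv_coordFun_frame, ← coframe_frame γ β p, coframe]
  rw [e]
  rw [mvfderiv_sum_mul d1 d2]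
  simp only [h1, Fin.sum_univ_three]
  rw [mvfderiv_eq_sum (fun q => transCoordLeft γ (frameVec 0) (incl (p⁻¹ * q))),
    mvfderiv_eq_sum (fun q => transCoordLeft γ (frameVec 1) (incl (p⁻¹ * q))),
    mvfderiv_eq_sum (fun q => transCoordLeft γ (frameVec 2) (incl (p⁻¹ * q)))]
  simp only [mvfderiv_transCoordLeft_frame, Fin.sum_univ_three]
  fin_cases γ <;> simp <;> ring

/-- The differential at `p` of `q ↦ coordFun γ (p⁻¹ * q)` is the coframe by definition, so the
commutator formula for this function computes the component; its second derivatives antisymmetrize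
to the structure constants. -/
theorem comp_mlieBracket {X Y : VField 𝓘(ℝ, Model) H31}
    (hX : IsSmoothField 𝓘(ℝ, Model) X) (hY : IsSmoothField 𝓘(ℝ, Model) Y) (γ : Fin 3) (p : H31) :
    comp γ (VectorField.mlieBracket 𝓘(ℝ, Model) X Y) p =
      mvfderiv 𝓘(ℝ, Model) (comp γ Y) p (X p) - mvfderiv 𝓘(ℝ, Model) (comp γ X) p (Y p) +
        ∑ α, ∑ β, bracketCoeff α β γ * (comp α X p * comp β Y p) := by
  have h := mvfderiv_mlieBracket hX hY (contMDiff_coordFun_mul_left γ p) p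
  rw [mvfderiv_mvfderiv_coordFun hX, mvfderiv_mvfderiv_coordFun hY] at h
  refine Eq.trans h ?_
  simp only [← transCoordLeft_frameVec_sub, Fin.sum_univ_three, comp]
  ring

/-! ### The flat connection of the left-invariant frame. -/

/-- Vector fields differentiable at a point. -/
abbrev DiffFieldAt (X : VField 𝓘(ℝ, Model) H31) (p : H31) : Prop :=
  MDifferentiableAt 𝓘(ℝ, Model) 𝓘(ℝ, Model).tangent
    (fun p => (⟨p, X p⟩ : TangentBundle 𝓘(ℝ, Model) H31)) p

theorem comp_add (γ : Fin 3) (X Y : VField 𝓘(ℝ, Model) H31) :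
    comp γ (X + Y) = comp γ X + comp γ Y := by
  funext p
  exact map_add (coframe γ p) (X p) (Y p)

theorem comp_sub (γ : Fin 3) (X Y : VField 𝓘(ℝ, Model) H31) :
    comp γ (X - Y) = comp γ X - comp γ Y := by
  funext p
  exact map_sub (coframe γ p) (X p) (Y p)

theorem comp_smul (γ : Fin 3) (f : H31 → ℝ) (X : VField 𝓘(ℝ, Model) H31) :
    comp γ (f • X) = f * comp γ X := by
  funext p
  exact map_smul (coframe γ p) (f p) (X p)

/-- The flat connection for which the left-invariant frame is parallel. -/
def flat : LinConnection 𝓘(ℝ, Model) H31 where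
  toFun σ p := ∑ γ, (mvfderiv 𝓘(ℝ, Model) (comp γ σ) p).smulRight (frame γ p)
  isCovariantDerivativeOnUniv :=
    { add := by
        intro σ τ p hσ hτ _
        rw [← Finset.sum_add_distrib]
        refine Finset.sum_congr rfl fun γ _ => ?_
        rw [comp_add, mvfderiv_add (mdifferentiableAt_comp γ hσ) (mdifferentiableAt_comp γ hτ)]
        ext v
        simp [add_smul]
      leibniz := by
        intro σ f p hσ hf _
        ext v
        have h := fun γ => mdifferentiableAt_comp γ hσ
        simp only [comp_smul, mvfderiv_mul hf (h _)]
        conv_rhs => rw [← sum_coframe_smul_frame p (σ p)]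
        simp only [Fin.sum_univ_three, comp]
        simp
        module }

theorem flat_apply (σ : VField 𝓘(ℝ, Model) H31) (p : H31) (v : TangentSpace 𝓘(ℝ, Model) p) :
    flat σ p v = ∑ γ, mvfderiv 𝓘(ℝ, Model) (comp γ σ) p v • frame γ p := by
  simp [flat]

theorem coframe_sum_smul_frame (γ : Fin 3) (p : H31) (c : Fin 3 → ℝ) :
    coframe γ p (∑ β, c β • frame β p) = c γ := by
  simp [map_sum, coframe_frame]

theorem coframe_flat (γ : Fin 3) (σ : VField 𝓘(ℝ, Model) H31) (p : H31)
    (v : TangentSpace 𝓘(ℝ, Model) p) :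
    coframe γ p (flat σ p v) = mvfderiv 𝓘(ℝ, Model) (comp γ σ) p v := by
  rw [flat_apply, coframe_sum_smul_frame]

theorem comp_flat (γ : Fin 3) (X Y : VField 𝓘(ℝ, Model) H31) :
    comp γ (flat.nabla X Y) = fun p => mvfderiv 𝓘(ℝ, Model) (comp γ Y) p (X p) := by
  funext p
  exact coframe_flat γ Y p (X p)

theorem flat_frame (α : Fin 3) (p : H31) : flat (frame α) p = 0 := by
  ext1 v
  refine ext_coframe fun γ => ?_
  rw [coframe_flat, comp_frame, mvfderiv_const]
  simp

/-- A connection is determined on differentiable fields by its values on the frame. -/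
theorem connection_apply (D : LinConnection 𝓘(ℝ, Model) H31) {σ : VField 𝓘(ℝ, Model) H31} {p : H31}
    (hσ : DiffFieldAt σ p) :
    D σ p = flat σ p + ∑ α, comp α σ p • D (frame α) p := by
  have h := fun α => mdifferentiableAt_comp α hσ
  have hF := fun α => (isSmoothField_frame α).mdifferentiableAt p
  have hs := fun α => (h α).smul_section (hF α)
  have c := D.isCovariantDerivativeOnUniv
  have e : σ = comp 0 σ • frame 0 + comp 1 σ • frame 1 + comp 2 σ • frame 2 := by
    conv_lhs => rw [eq_sum_comp_smul_frame σ]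
    rw [Fin.sum_univ_three]
  have e1 : D σ p = D (comp 0 σ • frame 0 + comp 1 σ • frame 1 + comp 2 σ • frame 2) p := by
    rw [← e]
  rw [e1, c.add (mdifferentiableAt_add_section (hs 0) (hs 1)) (hs 2), c.add (hs 0) (hs 1),
    c.leibniz (hF 0) (h 0), c.leibniz (hF 1) (h 1), c.leibniz (hF 2) (h 2)]
  ext1 v
  simp only [Fin.sum_univ_three, add_apply, smul_apply, ContinuousLinearMap.smulRight_apply,
    flat_apply]
  abel

/-! ### Left-invariant tensor fields; torsion and curvature of the flat connection. -/

/-- The left-invariant `(1,2)`-tensor field with components `c α β γ`. -/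
def constTensor (c : Fin 3 → Fin 3 → Fin 3 → ℝ) : Tensor12 𝓘(ℝ, Model) H31 := fun p =>
  ∑ α, ∑ β, ∑ γ, c α β γ • (coframe α p).smulRight ((coframe β p).smulRight (frame γ p))

theorem constTensor_apply (c : Fin 3 → Fin 3 → Fin 3 → ℝ) (p : H31)
    (u v : TangentSpace 𝓘(ℝ, Model) p) :
    constTensor c p u v =
      ∑ γ, (∑ α, ∑ β, c α β γ * (coframe α p u * coframe β p v)) • frame γ p := by
  simp only [constTensor, Fin.sum_univ_three, add_apply, smul_apply,
    ContinuousLinearMap.smulRight_apply]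
  module

theorem coframe_constTensor (c : Fin 3 → Fin 3 → Fin 3 → ℝ) (γ : Fin 3) (p : H31)
    (u v : TangentSpace 𝓘(ℝ, Model) p) :
    coframe γ p (constTensor c p u v) =
      ∑ α, ∑ β, c α β γ * (coframe α p u * coframe β p v) := by
  rw [constTensor_apply, coframe_sum_smul_frame]

theorem comp_constTensor (c : Fin 3 → Fin 3 → Fin 3 → ℝ) (γ : Fin 3)
    (X Y : VField 𝓘(ℝ, Model) H31) :
    comp γ ((constTensor c).eval X Y) =
      fun p => ∑ α, ∑ β, c α β γ * (comp α X p * comp β Y p) := by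
  funext p
  exact coframe_constTensor c γ p (X p) (Y p)

theorem constTensor_isSmooth (c : Fin 3 → Fin 3 → Fin 3 → ℝ) : (constTensor c).IsSmooth := by
  intro X Y hX hY
  refine isSmoothField_of_comp fun γ => ?_
  rw [comp_constTensor]
  refine contMDiff_finsetSum fun α _ => contMDiff_finsetSum fun β _ => ?_
  exact contMDiff_const.mul ((contMDiff_comp α hX).mul (contMDiff_comp β hY))

theorem mvfderiv_bilin (c : Fin 3 → Fin 3 → ℝ) {f g : Fin 3 → H31 → ℝ} {p : H31}
    (hf : ∀ β, MDifferentiableAt 𝓘(ℝ, Model) 𝓘(ℝ, ℝ) (f β) p)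
    (hg : ∀ β, MDifferentiableAt 𝓘(ℝ, Model) 𝓘(ℝ, ℝ) (g β) p) (v : TangentSpace 𝓘(ℝ, Model) p) :
    mvfderiv 𝓘(ℝ, Model) (fun q => ∑ α, ∑ β, c α β * (f α q * g β q)) p v =
      ∑ α, ∑ β, c α β * (mvfderiv 𝓘(ℝ, Model) (f α) p v * g β p) +
        ∑ α, ∑ β, c α β * (f α p * mvfderiv 𝓘(ℝ, Model) (g β) p v) := by
  have hc := fun α β => mdifferentiableAt_const (I := 𝓘(ℝ, Model)) (I' := 𝓘(ℝ, ℝ)) (c := c α β)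
    (x := p)
  -- Treating the coefficients as constant functions lets the product rule for a single sum be
  -- applied twice.
  have e : (fun q => ∑ α, ∑ β, c α β * (f α q * g β q)) =
      fun q => ∑ α, f α q * (fun q => ∑ β, (fun _ => c α β) q * g β q) q := by
    funext q
    refine Finset.sum_congr rfl fun α _ => ?_
    simp only [Finset.mul_sum]
    exact Finset.sum_congr rfl fun β _ => by ring
  have hd : ∀ α, MDifferentiableAt 𝓘(ℝ, Model) 𝓘(ℝ, ℝ)
      (fun q => ∑ β, (fun _ => c α β) q * g β q) p := by
    intro α
    simp only [Fin.sum_univ_three]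
    exact (((hc α 0).mul (hg 0)).add ((hc α 1).mul (hg 1))).add ((hc α 2).mul (hg 2))
  rw [e, mvfderiv_sum_mul hf hd]
  simp only [mvfderiv_sum_mul (hc _) hg, mvfderiv_const]
  rw [← Finset.sum_add_distrib]
  refine Finset.sum_congr rfl fun α _ => ?_
  rw [Finset.mul_sum, Finset.mul_sum, ← Finset.sum_add_distrib, ← Finset.sum_add_distrib]
  refine Finset.sum_congr rfl fun β _ => ?_
  simp
  ring

/-- Left-invariant tensor fields are parallel for the flat connection. -/
theorem flat_parallel_constTensor (c : Fin 3 → Fin 3 → Fin 3 → ℝ) :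
    flat.ParallelTensor (constTensor c) := by
  intro W X Y hW hX hY
  refine comp_ext fun γ => ?_
  rw [comp_flat, comp_add, comp_constTensor, comp_constTensor, comp_constTensor]
  funext p
  rw [Pi.add_apply, mvfderiv_bilin (fun α β => c α β γ)
    (fun α => (contMDiff_comp α hX).mdifferentiable (by simp) p)
    (fun α => (contMDiff_comp α hY).mdifferentiable (by simp) p)]
  simp only [comp_flat]

theorem isSmoothField_flat {X Y : VField 𝓘(ℝ, Model) H31} (hX : IsSmoothField 𝓘(ℝ, Model) X)
    (hY : IsSmoothField 𝓘(ℝ, Model) Y) : IsSmoothField 𝓘(ℝ, Model) (flat.nabla X Y) := by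
  refine isSmoothField_of_comp fun γ => ?_
  rw [comp_flat]
  exact (contMDiff_comp γ hY).mvfderiv_field hX

/-- The torsion of the flat connection. -/
theorem flat_torsion {X Y : VField 𝓘(ℝ, Model) H31} (hX : IsSmoothField 𝓘(ℝ, Model) X)
    (hY : IsSmoothField 𝓘(ℝ, Model) Y) :
    VectorField.mlieBracket 𝓘(ℝ, Model) X Y =
      flat.nabla X Y - flat.nabla Y X + (constTensor bracketCoeff).eval X Y := by
  refine comp_ext fun γ => ?_
  rw [comp_add, comp_sub, comp_flat, comp_flat, comp_constTensor]
  funext p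
  exact comp_mlieBracket hX hY γ p

/-- Componentwise the curvature is `XYf - YXf - [X, Y]f` with `f` a component of `Z`. -/
theorem flat_curvature {X Y Z : VField 𝓘(ℝ, Model) H31} (hX : IsSmoothField 𝓘(ℝ, Model) X)
    (hY : IsSmoothField 𝓘(ℝ, Model) Y) (hZ : IsSmoothField 𝓘(ℝ, Model) Z) :
    flat.curvature X Y Z = 0 := by
  refine comp_ext fun γ => ?_
  rw [LinConnection.curvature, comp_sub, comp_sub, comp_flat, comp_flat, comp_flat, comp_flat,
    comp_flat]
  funext p
  have h := mvfderiv_mlieBracket hX hY (contMDiff_comp γ hZ) p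
  have h0 : comp γ (0 : VField 𝓘(ℝ, Model) H31) p = 0 := map_zero (coframe γ p)
  rw [h0, Pi.sub_apply, Pi.sub_apply, h]
  ring

/-! ### The metric, the tensor field `S₀` and the Levi-Civita connection. -/

theorem metric_apply (l m n : ℝ) (p : H31) (v w : TangentSpace 𝓘(ℝ, Model) p) :
    metric l m n p v w = ∑ α, ![l, m, n] α * (coframe α p v * coframe α p w) := by
  simp [metric, Fin.sum_univ_three]

theorem metric_frame_right (l m n : ℝ) (γ : Fin 3) (p : H31) (v : TangentSpace 𝓘(ℝ, Model) p) :
    metric l m n p v (frame γ p) = ![l, m, n] γ * coframe γ p v := by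
  simp [metric_apply, coframe_frame]

theorem metric_symm (l m n : ℝ) (p : H31) (v w : TangentSpace 𝓘(ℝ, Model) p) :
    metric l m n p v w = metric l m n p w v := by
  simp only [metric_apply, mul_comm (coframe _ p v)]

theorem metric_eval (l m n : ℝ) (X Y : VField 𝓘(ℝ, Model) H31) :
    (metric l m n).eval X Y =
      fun p => ∑ α, ∑ β, (if α = β then ![l, m, n] α else 0) * (comp α X p * comp β Y p) := by
  funext p
  simp only [ite_mul, zero_mul, Finset.sum_ite_eq, Finset.mem_univ, if_true]
  exact metric_apply l m n p (X p) (Y p)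

theorem isPseudoRiemannianMetric_metric {l m n : ℝ} (hg : ∀ α, ![l, m, n] α ≠ 0) :
    IsPseudoRiemannianMetric (metric l m n) where
  symm := metric_symm l m n
  nondegenerate p v h := by
    refine ext_coframe fun γ => ?_
    have h' := h (frame γ p)
    rw [metric_frame_right] at h'
    rw [map_zero]
    exact (mul_eq_zero.1 h').resolve_left (hg γ)
  smooth X Y hX hY := by
    rw [metric_eval]
    refine contMDiff_finsetSum fun α _ => contMDiff_finsetSum fun β _ => ?_
    exact contMDiff_const.mul ((contMDiff_comp α hX).mul (contMDiff_comp β hY))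

theorem flat_parallelMetric (l m n : ℝ) : flat.ParallelMetric (metric l m n) := by
  intro W X Y hW hX hY p
  rw [metric_eval, metric_eval, metric_eval,
    mvfderiv_bilin (fun α β => if α = β then ![l, m, n] α else 0)
    (fun α => (contMDiff_comp α hX).mdifferentiable (by simp) p)
    (fun α => (contMDiff_comp α hY).mdifferentiable (by simp) p)]
  simp only [comp_flat]

/-- The components of the Levi-Civita connection, in the left-invariant frame, of the left-invariant
metric with components `g`, by the Koszul formula. -/
def structCoeff (g : Fin 3 → ℝ) (α β γ : Fin 3) : ℝ :=
  (bracketCoeff α β γ * g γ - bracketCoeff β γ α * g α + bracketCoeff γ α β * g β) / (2 * g γ)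

theorem mul_structCoeff {g : Fin 3 → ℝ} (hg : ∀ α, g α ≠ 0) (α β γ : Fin 3) :
    g γ * structCoeff g α β γ =
      (bracketCoeff α β γ * g γ - bracketCoeff β γ α * g α + bracketCoeff γ α β * g β) / 2 := by
  have := hg γ
  rw [structCoeff]
  field_simp

/-- This compensates the torsion of `flat`, so that `flat + structTensor` is torsion-free. -/
theorem structCoeff_sub {g : Fin 3 → ℝ} (hg : ∀ α, g α ≠ 0) (α β γ : Fin 3) :
    structCoeff g α β γ - structCoeff g β α γ = bracketCoeff α β γ := by
  have h := hg γ
  refine mul_left_cancel₀ h ?_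
  rw [mul_sub, mul_structCoeff hg, mul_structCoeff hg, bracketCoeff_antisymm β α γ,
    bracketCoeff_antisymm α γ β, bracketCoeff_antisymm γ β α]
  ring

/-- The tensor field `S₀`. -/
def structTensor (l m n : ℝ) : Tensor12 𝓘(ℝ, Model) H31 := constTensor (structCoeff ![l, m, n])

theorem metric_structTensor {l m n : ℝ} (hg : ∀ α, ![l, m, n] α ≠ 0) (p : H31)
    (u v w : TangentSpace 𝓘(ℝ, Model) p) :
    metric l m n p (structTensor l m n p u v) w = S0 l m n p u v w := by
  have h := mul_structCoeff hg
  have e : metric l m n p (structTensor l m n p u v) w =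
      ∑ γ, ∑ α, ∑ β, ![l, m, n] γ * structCoeff ![l, m, n] α β γ *
        (coframe α p u * coframe β p v * coframe γ p w) := by
    rw [metric_apply]
    refine Finset.sum_congr rfl fun γ _ => ?_
    rw [structTensor, coframe_constTensor, Finset.sum_mul, Finset.mul_sum]
    refine Finset.sum_congr rfl fun α _ => ?_
    rw [Finset.sum_mul, Finset.mul_sum]
    exact Finset.sum_congr rfl fun β _ => by ring
  rw [e]
  simp only [h, S0, wedge, Fin.sum_univ_three, bracketCoeff]
  simp
  ring

/-- Each term of `S0` is a wedge in its last two arguments. Skewness is what keeps `flat +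
structTensor` metric. -/
theorem structTensor_skew {l m n : ℝ} (hg : ∀ α, ![l, m, n] α ≠ 0) (p : H31)
    (u v w : TangentSpace 𝓘(ℝ, Model) p) :
    metric l m n p (structTensor l m n p u v) w + metric l m n p v (structTensor l m n p u w) =
      0 := by
  rw [metric_symm l m n p v, metric_structTensor hg, metric_structTensor hg, S0, S0]
  simp only [wedge]
  ring

theorem structTensor_sub {l m n : ℝ} (hg : ∀ α, ![l, m, n] α ≠ 0) (p : H31)
    (u v : TangentSpace 𝓘(ℝ, Model) p) :
    structTensor l m n p u v - structTensor l m n p v u = constTensor bracketCoeff p u v := by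
  refine ext_coframe fun γ => ?_
  rw [map_sub, structTensor, coframe_constTensor, coframe_constTensor, coframe_constTensor]
  rw [Finset.sum_comm (f := fun α β => structCoeff ![l, m, n] α β γ *
    (coframe α p v * coframe β p u)), ← Finset.sum_sub_distrib]
  refine Finset.sum_congr rfl fun α _ => ?_
  rw [← Finset.sum_sub_distrib]
  refine Finset.sum_congr rfl fun β _ => ?_
  rw [← structCoeff_sub hg]
  ring

/-- The Levi-Civita connection. -/
def leviCivita (l m n : ℝ) : LinConnection 𝓘(ℝ, Model) H31 :=
  flat.addOneForm fun p => ContinuousLinearMap.flip (E := Model) (F := Model) (G := Model)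
    (structTensor l m n p)

theorem leviCivita_nabla (l m n : ℝ) (X Y : VField 𝓘(ℝ, Model) H31) :
    (leviCivita l m n).nabla X Y = flat.nabla X Y + (structTensor l m n).eval X Y := rfl

theorem isLeviCivita_leviCivita {l m n : ℝ} (hg : ∀ α, ![l, m, n] α ≠ 0) :
    IsLeviCivita (metric l m n) (leviCivita l m n) where
  metric W X Y hW hX hY p := by
    rw [flat_parallelMetric l m n W X Y hW hX hY p, leviCivita_nabla, leviCivita_nabla]
    have h := structTensor_skew hg p (W p) (X p) (Y p)
    simp only [Tensor02.eval, Tensor12.eval, Pi.add_apply, map_add, add_apply]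
    linarith
  torsion_free X Y hX hY := by
    rw [leviCivita_nabla, leviCivita_nabla, flat_torsion hX hY]
    funext p
    have h := structTensor_sub hg p (X p) (Y p)
    simp only [Tensor12.eval, Pi.add_apply, Pi.sub_apply, ← h]
    abel

theorem IsLeviCivita.coframe_frame {l m n : ℝ} (hg : ∀ α, ![l, m, n] α ≠ 0)
    {D : LinConnection 𝓘(ℝ, Model) H31} (hD : IsLeviCivita (metric l m n) D) (α β γ : Fin 3)
    (p : H31) :
    coframe γ p (D (frame β) p (frame α p)) = structCoeff ![l, m, n] α β γ := by
  have hF := isSmoothField_frame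
  set g : Fin 3 → ℝ := ![l, m, n] with hgdef
  let a : Fin 3 → Fin 3 → Fin 3 → ℝ := fun α β γ => coframe γ p (D (frame β) p (frame α p))
  -- The frame has constant inner products, so metricity becomes skewness in the last two indices.
  -- Together with `T` over the cyclic permutations of the indices this is the linear system solved
  -- by the Koszul formula.
  have M : ∀ α β γ, g γ * a α β γ + g β * a α γ β = 0 := by
    intro α β γ
    have h := hD.metric (frame α) (frame β) (frame γ) (hF α) (hF β) (hF γ) p
    have e : (metric l m n).eval (frame β) (frame γ) =
        fun _ => if γ = β then ![l, m, n] γ else 0 := by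
      funext q
      rw [Tensor02.eval, metric_frame_right, H31.coframe_frame]
      simp
    rw [e, mvfderiv_const] at h
    rw [Tensor02.eval, Tensor02.eval, metric_frame_right, metric_symm, metric_frame_right] at h
    exact h.symm
  have T : ∀ α β γ, g γ * a α β γ - g γ * a β α γ = g γ * bracketCoeff α β γ := by
    intro α β γ
    have h := hD.torsion_free (frame α) (frame β) (hF α) (hF β)
    have h1 : comp γ (D.nabla (frame α) (frame β) - D.nabla (frame β) (frame α)) p =
        comp γ (VectorField.mlieBracket 𝓘(ℝ, Model) (frame α) (frame β)) p := by rw [h]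
    rw [comp_sub, comp_mlieBracket (hF α) (hF β)] at h1
    simp only [comp_frame, mvfderiv_const] at h1
    have h2 : a α β γ - a β α γ = bracketCoeff α β γ := by
      refine Eq.trans h1 ?_
      simp
    rw [← mul_sub, h2]
  refine mul_left_cancel₀ (hg γ) ?_
  rw [mul_structCoeff hg]
  change g γ * a α β γ = _
  have m1 := M α β γ
  have m2 := M β γ α
  have m3 := M γ α β
  have t1 := T α β γ
  have t2 := T β γ α
  have t3 := T γ α β
  linarith

theorem IsLeviCivita.apply_frame {l m n : ℝ} (hg : ∀ α, ![l, m, n] α ≠ 0)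
    {D : LinConnection 𝓘(ℝ, Model) H31} (hD : IsLeviCivita (metric l m n) D) (β : Fin 3) (p : H31)
    (v : TangentSpace 𝓘(ℝ, Model) p) :
    D (frame β) p v = structTensor l m n p v (frame β p) := by
  refine ext_coframe fun γ => ?_
  conv_lhs => rw [← sum_coframe_smul_frame p v]
  rw [structTensor, coframe_constTensor, map_sum, map_sum]
  refine Finset.sum_congr rfl fun α _ => ?_
  rw [map_smul, map_smul, IsLeviCivita.coframe_frame hg hD]
  simp [H31.coframe_frame, mul_comm]

/-- The Leibniz rule extends the values on the frame, so all Levi-Civita connections agree on fields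
differentiable at the point. -/
theorem IsLeviCivita.apply {l m n : ℝ} (hg : ∀ α, ![l, m, n] α ≠ 0)
    {D : LinConnection 𝓘(ℝ, Model) H31} (hD : IsLeviCivita (metric l m n) D)
    {σ : VField 𝓘(ℝ, Model) H31} {p : H31} (hσ : DiffFieldAt σ p)
    (v : TangentSpace 𝓘(ℝ, Model) p) :
    D σ p v = flat σ p v + structTensor l m n p v (σ p) := by
  rw [connection_apply D hσ, add_apply]
  congr 1
  conv_rhs => rw [← sum_coframe_smul_frame p (σ p)]
  simp only [map_sum, map_smul, sum_apply, smul_apply, IsLeviCivita.apply_frame hg hD]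
  rfl

theorem IsLeviCivita.nabla {l m n : ℝ} (hg : ∀ α, ![l, m, n] α ≠ 0)
    {D : LinConnection 𝓘(ℝ, Model) H31} (hD : IsLeviCivita (metric l m n) D)
    (X : VField 𝓘(ℝ, Model) H31) {Y : VField 𝓘(ℝ, Model) H31} (hY : IsSmoothField 𝓘(ℝ, Model) Y) :
    D.nabla X Y = flat.nabla X Y + (structTensor l m n).eval X Y := by
  funext p
  exact IsLeviCivita.apply hg hD (hY.mdifferentiableAt p) (X p)

theorem IsLeviCivita.canonical_nabla {l m n : ℝ} (hg : ∀ α, ![l, m, n] α ≠ 0)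
    {D : LinConnection 𝓘(ℝ, Model) H31} (hD : IsLeviCivita (metric l m n) D)
    (X : VField 𝓘(ℝ, Model) H31) {Y : VField 𝓘(ℝ, Model) H31} (hY : IsSmoothField 𝓘(ℝ, Model) Y) :
    (D.canonical (structTensor l m n)).nabla X Y = flat.nabla X Y := by
  rw [LinConnection.canonical_nabla, IsLeviCivita.nabla hg hD X hY]
  abel

/-! ### Curvature of the Levi-Civita connection, and `S₀` as a homogeneous structure. -/

/-- The curvature of `flat + S` for a left-invariant tensor field `S` such that this connection is
torsion-free. -/
def curvEval (S : Tensor12 𝓘(ℝ, Model) H31) (X Y Z : VField 𝓘(ℝ, Model) H31) :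
    VField 𝓘(ℝ, Model) H31 :=
  S.eval X (S.eval Y Z) - S.eval Y (S.eval X Z) - S.eval (S.eval X Y - S.eval Y X) Z

section

variable (S : Tensor12 𝓘(ℝ, Model) H31) (X Y Z : VField 𝓘(ℝ, Model) H31)

theorem eval_add_right : S.eval X (Y + Z) = S.eval X Y + S.eval X Z := by
  funext p
  exact map_add (S p (X p)) (Y p) (Z p)

theorem eval_add_left : S.eval (X + Y) Z = S.eval X Z + S.eval Y Z := by
  funext p
  simp [Tensor12.eval]

theorem eval_sub_left : S.eval (X - Y) Z = S.eval X Z - S.eval Y Z := by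
  funext p
  simp [Tensor12.eval]

end

theorem flat_nabla_add (X : VField 𝓘(ℝ, Model) H31) {Y Z : VField 𝓘(ℝ, Model) H31}
    (hY : IsSmoothField 𝓘(ℝ, Model) Y) (hZ : IsSmoothField 𝓘(ℝ, Model) Z) :
    flat.nabla X (Y + Z) = flat.nabla X Y + flat.nabla X Z := by
  funext p
  exact DFunLike.congr_fun (flat.isCovariantDerivativeOnUniv.add (hY.mdifferentiableAt p)
    (hZ.mdifferentiableAt p)) (X p)

theorem flat_nabla_sub (X : VField 𝓘(ℝ, Model) H31) {Y Z : VField 𝓘(ℝ, Model) H31}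
    (hY : IsSmoothField 𝓘(ℝ, Model) Y) (hZ : IsSmoothField 𝓘(ℝ, Model) Z) :
    flat.nabla X (Y - Z) = flat.nabla X Y - flat.nabla X Z := by
  have h := flat_nabla_add X (hY.sub hZ) hZ
  rw [sub_add_cancel] at h
  rw [h, add_sub_cancel_right]

theorem curvEval_isSmooth {S : Tensor12 𝓘(ℝ, Model) H31} (hS : S.IsSmooth)
    {X Y Z : VField 𝓘(ℝ, Model) H31} (hX : IsSmoothField 𝓘(ℝ, Model) X)
    (hY : IsSmoothField 𝓘(ℝ, Model) Y) (hZ : IsSmoothField 𝓘(ℝ, Model) Z) :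
    IsSmoothField 𝓘(ℝ, Model) (curvEval S X Y Z) :=
  ((hS _ _ hX (hS _ _ hY hZ)).sub (hS _ _ hY (hS _ _ hX hZ))).sub
    (hS _ _ ((hS _ _ hX hY).sub (hS _ _ hY hX)) hZ)

/-- The curvature expression is an algebraic composite of `S` with itself, so it inherits
parallelism by the product rule. -/
theorem flat_parallel_curvEval {S : Tensor12 𝓘(ℝ, Model) H31} (hS : S.IsSmooth)
    (hp : flat.ParallelTensor S) {W X Y Z : VField 𝓘(ℝ, Model) H31}
    (hW : IsSmoothField 𝓘(ℝ, Model) W) (hX : IsSmoothField 𝓘(ℝ, Model) X)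
    (hY : IsSmoothField 𝓘(ℝ, Model) Y) (hZ : IsSmoothField 𝓘(ℝ, Model) Z) :
    flat.nabla W (curvEval S X Y Z) =
      curvEval S (flat.nabla W X) Y Z + curvEval S X (flat.nabla W Y) Z +
        curvEval S X Y (flat.nabla W Z) := by
  have hXY := hS _ _ hX hY
  have hYX := hS _ _ hY hX
  have hXZ := hS _ _ hX hZ
  have hYZ := hS _ _ hY hZ
  simp only [curvEval]
  rw [flat_nabla_sub W ((hS _ _ hX hYZ).sub (hS _ _ hY hXZ)) (hS _ _ (hXY.sub hYX) hZ),
    flat_nabla_sub W (hS _ _ hX hYZ) (hS _ _ hY hXZ), hp W _ _ hW hX hYZ, hp W _ _ hW hY hXZ,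
    hp W _ _ hW hY hZ, hp W _ _ hW hX hZ, hp W _ _ hW (hXY.sub hYX) hZ,
    flat_nabla_sub W hXY hYX, hp W _ _ hW hX hY, hp W _ _ hW hY hX]
  simp only [eval_add_right, eval_add_left, eval_sub_left]
  abel

/-- In the curvature of `flat + S` the purely flat part vanishes, the derivatives of `S` vanish
because `S` is parallel, and torsion-freeness trades the bracket for `S`. Only terms quadratic in
`S` survive. -/
theorem IsLeviCivita.curvature {l m n : ℝ} (hg : ∀ α, ![l, m, n] α ≠ 0)
    {D : LinConnection 𝓘(ℝ, Model) H31} (hD : IsLeviCivita (metric l m n) D)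
    {X Y Z : VField 𝓘(ℝ, Model) H31} (hX : IsSmoothField 𝓘(ℝ, Model) X)
    (hY : IsSmoothField 𝓘(ℝ, Model) Y) (hZ : IsSmoothField 𝓘(ℝ, Model) Z) :
    D.curvature X Y Z = curvEval (structTensor l m n) X Y Z := by
  have hS : (structTensor l m n).IsSmooth := constTensor_isSmooth _
  have hp : flat.ParallelTensor (structTensor l m n) := flat_parallel_constTensor _
  have hXZ := isSmoothField_flat hX hZ
  have hYZ := isSmoothField_flat hY hZ
  have f := flat_curvature hX hY hZ
  have ht : VectorField.mlieBracket 𝓘(ℝ, Model) X Y = flat.nabla X Y - flat.nabla Y X +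
      ((structTensor l m n).eval X Y - (structTensor l m n).eval Y X) := by
    rw [← hD.torsion_free X Y hX hY, IsLeviCivita.nabla hg hD X hY, IsLeviCivita.nabla hg hD Y hX]
    abel
  rw [LinConnection.curvature, sub_sub] at f
  have f' := sub_eq_zero.1 f
  rw [LinConnection.curvature, IsLeviCivita.nabla hg hD Y hZ, IsLeviCivita.nabla hg hD X hZ,
    IsLeviCivita.nabla hg hD X (hYZ.add (hS _ _ hY hZ)),
    IsLeviCivita.nabla hg hD Y (hXZ.add (hS _ _ hX hZ)), IsLeviCivita.nabla hg hD _ hZ,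
    flat_nabla_add X hYZ (hS _ _ hY hZ), flat_nabla_add Y hXZ (hS _ _ hX hZ), hp X Y Z hX hY hZ,
    hp Y X Z hY hX hZ, f']
  -- The bracket is expanded only inside the `S` term. In `flat.nabla [X, Y] Z` it stays intact, to
  -- cancel the term introduced by `f'`.
  conv_lhs => enter [2, 2, 2]; rw [ht]
  simp only [curvEval, eval_add_right, eval_add_left, eval_sub_left]
  abel

theorem isHomogeneousStructure_structTensor {l m n : ℝ} (hg : ∀ α, ![l, m, n] α ≠ 0)
    {D : LinConnection 𝓘(ℝ, Model) H31} (hD : IsLeviCivita (metric l m n) D) :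
    IsHomogeneousStructure (metric l m n) D (structTensor l m n) := by
  have hS : (structTensor l m n).IsSmooth := constTensor_isSmooth _
  have hp : flat.ParallelTensor (structTensor l m n) := flat_parallel_constTensor _
  have hc := fun X {Y} (hY : IsSmoothField 𝓘(ℝ, Model) Y) =>
    IsLeviCivita.canonical_nabla hg hD X hY
  refine ⟨hS, ?_, ?_, ?_⟩
  · intro W X Y hW hX hY p
    rw [hc W hX, hc W hY]
    exact flat_parallelMetric l m n W X Y hW hX hY p
  · intro W X Y Z hW hX hY hZ
    rw [hc W hX, hc W hY, hc W hZ, IsLeviCivita.curvature hg hD hX hY hZ,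
      IsLeviCivita.curvature hg hD (isSmoothField_flat hW hX) hY hZ,
      IsLeviCivita.curvature hg hD hX (isSmoothField_flat hW hY) hZ,
      IsLeviCivita.curvature hg hD hX hY (isSmoothField_flat hW hZ),
      hc W (curvEval_isSmooth hS hX hY hZ)]
    exact flat_parallel_curvEval hS hp hW hX hY hZ
  · intro W X Y hW hX hY
    rw [hc W hX, hc W hY, hc W (hS _ _ hX hY)]
    exact hp W X Y hW hX hY

theorem canonical_curvature {l m n : ℝ} (hg : ∀ α, ![l, m, n] α ≠ 0)
    {D : LinConnection 𝓘(ℝ, Model) H31} (hD : IsLeviCivita (metric l m n) D)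
    {X Y Z : VField 𝓘(ℝ, Model) H31} (hX : IsSmoothField 𝓘(ℝ, Model) X)
    (hY : IsSmoothField 𝓘(ℝ, Model) Y) (hZ : IsSmoothField 𝓘(ℝ, Model) Z) :
    (D.canonical (structTensor l m n)).curvature X Y Z = 0 := by
  rw [LinConnection.curvature, IsLeviCivita.canonical_nabla hg hD Y hZ,
    IsLeviCivita.canonical_nabla hg hD X hZ,
    IsLeviCivita.canonical_nabla hg hD X (isSmoothField_flat hY hZ),
    IsLeviCivita.canonical_nabla hg hD Y (isSmoothField_flat hX hZ),
    IsLeviCivita.canonical_nabla hg hD _ hZ]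
  exact flat_curvature hX hY hZ

/-! ### Uniqueness -/

theorem structTensor_frame (l m n : ℝ) (α β : Fin 3) (p : H31) :
    structTensor l m n p (frame α p) (frame β p) =
      ∑ γ, structCoeff ![l, m, n] α β γ • frame γ p := by
  refine ext_coframe fun γ => ?_
  rw [coframe_sum_smul_frame, structTensor, coframe_constTensor]
  simp [coframe_frame]

/-- The components of the curvature of `flat + S`. -/
def curvCoeff (s : Fin 3 → Fin 3 → Fin 3 → ℝ) (α β γ ε : Fin 3) : ℝ :=
  ∑ κ, (s β γ κ * s α κ ε - s α γ κ * s β κ ε - (s α β κ - s β α κ) * s κ γ ε)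

theorem coframe_curvEval (l m n : ℝ) (X Y Z : VField 𝓘(ℝ, Model) H31) (ε : Fin 3) (p : H31) :
    coframe ε p (curvEval (structTensor l m n) X Y Z p) =
      ∑ α, ∑ β, ∑ γ, curvCoeff (structCoeff ![l, m, n]) α β γ ε *
        (comp α X p * comp β Y p * comp γ Z p) := by
  simp only [curvEval, Tensor12.eval, Pi.sub_apply, map_sub, structTensor, coframe_constTensor,
    sub_apply, curvCoeff, Fin.sum_univ_three, comp]
  ring

/-- The coefficients vanish unless the three indices are distinct. Hence `R(X_α, X_β)X_β` is a
multiple of `X_α`, and the curvature equations below decouple. -/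
theorem structCoeff_eq {l m n : ℝ} (hl : l ≠ 0) (hm : m ≠ 0) (hn : n ≠ 0) :
    structCoeff ![l, m, n] =
      ![![![0, 0, 0], ![0, 0, (l + m + n) / n], ![0, -(l + m + n) / m, 0]],
        ![![0, 0, (l + m - n) / n], ![0, 0, 0], ![-(l + m - n) / l, 0, 0]],
        ![![0, -(l - m + n) / m, 0], ![(l - m + n) / l, 0, 0], ![0, 0, 0]]] := by
  funext α β γ
  fin_cases α <;> fin_cases β <;> fin_cases γ <;> simp [structCoeff, bracketCoeff] <;>
    field_simp <;> ring

/-- The components of `S - S₀`. -/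
def diffComp (l m n : ℝ) (S : Tensor12 𝓘(ℝ, Model) H31) (δ α γ : Fin 3) (p : H31) : ℝ :=
  comp γ (S.eval (frame δ) (frame α)) p - structCoeff ![l, m, n] δ α γ

theorem comp_eval_frame (l m n : ℝ) (S : Tensor12 𝓘(ℝ, Model) H31) (δ α γ : Fin 3) (p : H31) :
    comp γ (S.eval (frame δ) (frame α)) p =
      structCoeff ![l, m, n] δ α γ + diffComp l m n S δ α γ p := by
  rw [diffComp, add_sub_cancel]

theorem comp_eval (l m n : ℝ) (S : Tensor12 𝓘(ℝ, Model) H31) (X Y : VField 𝓘(ℝ, Model) H31)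
    (γ : Fin 3) (p : H31) :
    comp γ (S.eval X Y) p = ∑ α, ∑ β, (structCoeff ![l, m, n] α β γ + diffComp l m n S α β γ p) *
      (comp α X p * comp β Y p) := by
  simp only [← comp_eval_frame]
  change coframe γ p (S p (X p) (Y p)) = _
  conv_lhs => rw [← sum_coframe_smul_frame p (X p), ← sum_coframe_smul_frame p (Y p)]
  simp only [map_sum, map_smul, sum_apply, smul_apply, smul_eq_mul, Finset.mul_sum]
  rw [Finset.sum_comm]
  refine Finset.sum_congr rfl fun α _ => Finset.sum_congr rfl fun β _ => ?_
  simp only [comp, Tensor12.eval]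
  ring

section

variable {l m n : ℝ} (hg : ∀ α, ![l, m, n] α ≠ 0) {D : LinConnection 𝓘(ℝ, Model) H31}
  (hD : IsLeviCivita (metric l m n) D) {S : Tensor12 𝓘(ℝ, Model) H31}
  (hS : IsHomogeneousStructure (metric l m n) D S)

include hg hD

/-- On smooth fields `∇ - S = flat - (S - S₀)`: a derivative of components, corrected by the
endomorphism `t_δ` with entries `diffComp l m n S δ`. -/
theorem comp_canonical_nabla_frame (S : Tensor12 𝓘(ℝ, Model) H31)
    {X : VField 𝓘(ℝ, Model) H31} (hX : IsSmoothField 𝓘(ℝ, Model) X)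
    (δ γ : Fin 3) (p : H31) :
    comp γ ((D.canonical S).nabla (frame δ) X) p =
      mvfderiv 𝓘(ℝ, Model) (comp γ X) p (frame δ p) -
        ∑ α, diffComp l m n S δ α γ p * comp α X p := by
  rw [LinConnection.canonical_nabla, IsLeviCivita.nabla hg hD _ hX, comp_sub, comp_add, comp_flat,
    structTensor, comp_constTensor, Pi.sub_apply, Pi.add_apply, comp_eval l m n S]
  simp only [comp_frame, Fin.sum_univ_three]
  fin_cases δ <;> simp <;> ring

theorem comp_canonical_nabla_frame_frame (S : Tensor12 𝓘(ℝ, Model) H31) (δ α γ : Fin 3) (p : H31) :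
    comp γ ((D.canonical S).nabla (frame δ) (frame α)) p = -diffComp l m n S δ α γ p := by
  rw [comp_canonical_nabla_frame hg hD S (isSmoothField_frame α), comp_frame, mvfderiv_const]
  simp [comp_frame]

include hS

theorem isSmoothField_canonical {W X : VField 𝓘(ℝ, Model) H31} (hW : IsSmoothField 𝓘(ℝ, Model) W)
    (hX : IsSmoothField 𝓘(ℝ, Model) X) :
    IsSmoothField 𝓘(ℝ, Model) ((D.canonical S).nabla W X) := by
  rw [LinConnection.canonical_nabla, IsLeviCivita.nabla hg hD _ hX]
  exact ((isSmoothField_flat hW hX).add (constTensor_isSmooth _ _ _ hW hX)).sub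
    (hS.smooth _ _ hW hX)

theorem diffComp_skew (δ α γ : Fin 3) (p : H31) :
    ![l, m, n] γ * diffComp l m n S δ α γ p + ![l, m, n] α * diffComp l m n S δ γ α p = 0 := by
  have hF := isSmoothField_frame
  have h := hS.metric (frame δ) (frame α) (frame γ) (hF δ) (hF α) (hF γ) p
  have e : (metric l m n).eval (frame α) (frame γ) =
      fun _ => if γ = α then ![l, m, n] γ else 0 := by
    funext q
    rw [Tensor02.eval, metric_frame_right, coframe_frame]
    simp
  rw [e, mvfderiv_const] at h
  rw [Tensor02.eval, Tensor02.eval, metric_frame_right, metric_symm, metric_frame_right] at h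
  have h1 := comp_canonical_nabla_frame_frame hg hD S δ α γ p
  have h2 := comp_canonical_nabla_frame_frame hg hD S δ γ α p
  simp only [comp] at h1 h2
  rw [h1, h2] at h
  have h' : (0 : ℝ) = _ := h
  linarith

/-- The curvature has constant components, so the derivative term in its parallelism disappears,
leaving that `t_δ` acts trivially on it as a derivation. -/
theorem diffComp_curvature (δ α β γ ε : Fin 3) (p : H31) :
    ∑ κ, diffComp l m n S δ κ ε p * curvCoeff (structCoeff ![l, m, n]) α β γ κ =
      ∑ κ, (diffComp l m n S δ α κ p * curvCoeff (structCoeff ![l, m, n]) κ β γ ε +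
        diffComp l m n S δ β κ p * curvCoeff (structCoeff ![l, m, n]) α κ γ ε +
        diffComp l m n S δ γ κ p * curvCoeff (structCoeff ![l, m, n]) α β κ ε) := by
  have hF := isSmoothField_frame
  have hn := fun α => isSmoothField_canonical hg hD hS (hF δ) (hF α)
  have hsm : (structTensor l m n).IsSmooth := constTensor_isSmooth _
  have h := hS.curvature (frame δ) (frame α) (frame β) (frame γ) (hF δ) (hF α) (hF β) (hF γ)
  rw [IsLeviCivita.curvature hg hD (hF α) (hF β) (hF γ),
    IsLeviCivita.curvature hg hD (hn α) (hF β) (hF γ),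
    IsLeviCivita.curvature hg hD (hF α) (hn β) (hF γ),
    IsLeviCivita.curvature hg hD (hF α) (hF β) (hn γ)] at h
  have hc : ∀ κ, comp κ (curvEval (structTensor l m n) (frame α) (frame β) (frame γ)) =
      fun _ => curvCoeff (structCoeff ![l, m, n]) α β γ κ := by
    intro κ
    funext q
    refine (coframe_curvEval l m n _ _ _ κ q).trans ?_
    simp [comp_frame, Finset.sum_ite_eq']
  have h' := congrArg (fun X => comp ε X p) h
  rw [comp_canonical_nabla_frame hg hD S (curvEval_isSmooth hsm (hF α) (hF β) (hF γ)), comp_add,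
    comp_add, Pi.add_apply, Pi.add_apply, hc, mvfderiv_const] at h'
  simp only [hc] at h'
  have e := fun X Y Z => coframe_curvEval l m n X Y Z ε p
  simp only [comp] at h'
  rw [e, e, e] at h'
  simp only [comp_canonical_nabla_frame_frame hg hD, comp_frame] at h'
  simp only [mul_ite, mul_one, mul_zero, ite_mul, one_mul, zero_mul, Finset.sum_ite_eq',
    Finset.mem_univ, if_true, zero_apply, Finset.sum_ite_irrel, Finset.sum_const_zero] at h'
  rw [Finset.sum_add_distrib, Finset.sum_add_distrib]
  simp only [mul_neg, Finset.sum_neg_distrib, zero_sub] at h'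
  simp only [mul_comm (curvCoeff _ _ _ _ _)] at h'
  linarith

/-- Vanishing at every point is required: it makes this component of `S` a constant function, so
that parallelism of `S` contains no derivative. -/
theorem diffComp_tensor {α β γ : Fin 3} (hz : ∀ q, diffComp l m n S α β γ q = 0) (δ : Fin 3)
    (p : H31) :
    ∑ κ, diffComp l m n S δ κ γ p * (structCoeff ![l, m, n] α β κ + diffComp l m n S α β κ p) =
      ∑ κ, (diffComp l m n S δ α κ p *
          (structCoeff ![l, m, n] κ β γ + diffComp l m n S κ β γ p) +
        diffComp l m n S δ β κ p *
          (structCoeff ![l, m, n] α κ γ + diffComp l m n S α κ γ p)) := by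
  have hF := isSmoothField_frame
  have h := hS.tensor (frame δ) (frame α) (frame β) (hF δ) (hF α) (hF β)
  have h' := congrArg (fun X => comp γ X p) h
  have hc : comp γ (S.eval (frame α) (frame β)) = fun _ => structCoeff ![l, m, n] α β γ := by
    funext q
    rw [comp_eval_frame l m n, hz, add_zero]
  rw [comp_canonical_nabla_frame hg hD S (hS.smooth _ _ (hF α) (hF β)), comp_add, Pi.add_apply,
    hc, mvfderiv_const, comp_eval l m n S, comp_eval l m n S] at h'
  simp only [comp_canonical_nabla_frame_frame hg hD, comp_frame, comp_eval_frame l m n] at h'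
  simp only [mul_ite, mul_one, mul_zero, ite_mul, one_mul, zero_mul, Finset.sum_ite_eq',
    Finset.mem_univ, if_true, zero_apply, Finset.sum_ite_irrel, Finset.sum_const_zero] at h'
  rw [Finset.sum_add_distrib]
  simp only [mul_neg, Finset.sum_neg_distrib, zero_sub] at h'
  simp only [mul_comm (_ + _) (diffComp _ _ _ _ _ _ _ _)] at h'
  linarith

end

section

variable {l m n : ℝ} (hl : l ≠ 0) (hm : m ≠ 0) (hn : n ≠ 0) {t : Fin 3 → Fin 3 → ℝ}
  (ht : ∀ i, t i i = 0)
  (h : ∀ α β γ ε, ∑ κ, t κ ε * curvCoeff (structCoeff ![l, m, n]) α β γ κ =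
    ∑ κ, (t α κ * curvCoeff (structCoeff ![l, m, n]) κ β γ ε +
      t β κ * curvCoeff (structCoeff ![l, m, n]) α κ γ ε +
      t γ κ * curvCoeff (structCoeff ![l, m, n]) α β κ ε))

include hl hm hn ht h

/-- For these indices the equation reads `t 2 1` times the difference of the coefficients of `R(X₂,
X₀)X₀` along `X₂` and of `R(X₁, X₀)X₀` along `X₁`. Up to sign the difference is `4 (n - m) (l + m +
n) / (m n)`. The next two lemmas are the analogues for the other entries. -/
theorem eq_zero_or_of_curvature_21 (hmn : m ≠ n) : t 2 1 = 0 ∨ l + m + n = 0 := by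
  have h := h 2 0 0 1
  rw [structCoeff_eq hl hm hn] at h
  simp only [curvCoeff, Fin.sum_univ_three, ht] at h
  simp at h
  rcases h with h | h
  · right
    have h2 : 4 * (n - m) * (l + m + n) / (m * n) = 0 := by
      rw [← sub_eq_zero.2 h]
      field_simp
      ring
    simpa [hm, hn, sub_eq_zero, hmn.symm] using h2
  · exact Or.inl h

theorem eq_zero_or_of_curvature_02 (hnl : n ≠ -l) : t 0 2 = 0 ∨ l + m - n = 0 := by
  have h := h 0 1 1 2
  rw [structCoeff_eq hl hm hn] at h
  simp only [curvCoeff, Fin.sum_univ_three, ht] at h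
  simp at h
  rcases h with h | h
  · right
    have h2 : 4 * (n + l) * (l + m - n) / (l * n) = 0 := by
      rw [← sub_eq_zero.2 h]
      field_simp
      ring
    have : n + l ≠ 0 := fun h => hnl (eq_neg_of_add_eq_zero_left h)
    simpa [hl, hn, this] using h2
  · exact Or.inl h

theorem eq_zero_or_of_curvature_10 (hlm : -l ≠ m) : t 1 0 = 0 ∨ l - m + n = 0 := by
  have h := h 1 2 2 0
  rw [structCoeff_eq hl hm hn] at h
  simp only [curvCoeff, Fin.sum_univ_three, ht] at h
  simp at h
  rcases h with h | h
  · right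
    have h2 : -4 * (m + l) * (l - m + n) / (l * m) = 0 := by
      rw [← sub_eq_zero.2 h]
      field_simp
      ring
    have : m + l ≠ 0 := fun h => hlm (eq_neg_of_add_eq_zero_left h).symm
    simpa [hl, hm, this] using h2
  · exact Or.inl h

end

section

variable {l m n : ℝ} (hg : ∀ α, ![l, m, n] α ≠ 0) {D : LinConnection 𝓘(ℝ, Model) H31}
  (hD : IsLeviCivita (metric l m n) D) {S : Tensor12 𝓘(ℝ, Model) H31}
  (hS : IsHomogeneousStructure (metric l m n) D S)

include hg hD hS

theorem diffComp_eq_zero (hlm : -l ≠ m) (hmn : m ≠ n) (hnl : n ≠ -l) (δ α γ : Fin 3) (p : H31) :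
    diffComp l m n S δ α γ p = 0 := by
  have hl : l ≠ 0 := hg 0
  have hm : m ≠ 0 := hg 1
  have hn : n ≠ 0 := hg 2
  have sk := diffComp_skew hg hD hS
  have hd : ∀ δ α p, diffComp l m n S δ α α p = 0 := by
    intro δ α p
    have h := sk δ α α p
    have h2 := hg α
    have : ![l, m, n] α * diffComp l m n S δ α α p = 0 := by linarith
    exact (mul_eq_zero.1 this).resolve_left h2
  -- Skewness lets the vanishing of an entry pass to the transposed one, so the entries `21`, `02`
  -- and `10` suffice.
  have sw : ∀ {α γ : Fin 3}, (∀ δ p, diffComp l m n S δ α γ p = 0) →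
      ∀ δ p, diffComp l m n S δ γ α p = 0 := by
    intro α γ h δ p
    have h1 := sk δ α γ p
    rw [h, mul_zero, zero_add] at h1
    exact (mul_eq_zero.1 h1).resolve_left (hg α)
  have C := fun δ p α β γ ε => diffComp_curvature hg hD hS δ α β γ ε p
  have x := fun δ p => eq_zero_or_of_curvature_21 hl hm hn
    (t := fun α γ => diffComp l m n S δ α γ p) (fun α => hd δ α p) (C δ p) hmn
  have y := fun δ p => eq_zero_or_of_curvature_02 hl hm hn
    (t := fun α γ => diffComp l m n S δ α γ p) (fun α => hd δ α p) (C δ p) hnl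
  have z := fun δ p => eq_zero_or_of_curvature_10 hl hm hn
    (t := fun α γ => diffComp l m n S δ α γ p) (fun α => hd δ α p) (C δ p) hlm
  have T := fun α β γ h => diffComp_tensor hg hD hS (α := α) (β := β) (γ := γ) h
  have ex : l + m + n ≠ 0 → ∀ δ p, diffComp l m n S δ 2 1 p = 0 :=
    fun h δ p => (x δ p).resolve_right h
  have ey : l + m - n ≠ 0 → ∀ δ p, diffComp l m n S δ 0 2 p = 0 :=
    fun h δ p => (y δ p).resolve_right h
  have ez : l - m + n ≠ 0 → ∀ δ p, diffComp l m n S δ 1 0 p = 0 :=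
    fun h δ p => (z δ p).resolve_right h
  have all : (∀ δ p, diffComp l m n S δ 2 1 p = 0) ∧ (∀ δ p, diffComp l m n S δ 0 2 p = 0) ∧
      (∀ δ p, diffComp l m n S δ 1 0 p = 0) := by
    -- Any two of the three forms have a sum or difference equal to `2l`, `2m` or `2n`, so if one
    -- vanishes the others do not.
    by_cases h0 : l + m + n = 0
    · have y' := ey (by contrapose! hn; linarith)
      have z' := ez (by contrapose! hm; linarith)
      refine ⟨fun δ p => ?_, y', z'⟩
      -- The component of `S` with indices `1, 0, 1` is identically zero. Its equation pairs the
      -- entries `21` and `12` of `t_δ`; after elimination of `12` by skewness the coefficient is a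
      -- nonzero multiple of `m - n`. The other two cases are analogous, with `n + l` and `m + l`.
      have e := T 1 0 1 (sw z' 1) δ p
      rw [structCoeff_eq hl hm hn] at e
      simp only [Fin.sum_univ_three, hd, y', z', sw z'] at e
      have s := sk δ 1 2 p
      simp at e s
      have e' : m * (m - n) * diffComp l m n S δ 2 1 p = 0 := by
        field_simp at e
        linear_combination (1 / 2) * e + (m - n - l) / 2 * s
      exact (mul_eq_zero.1 e').resolve_left (mul_ne_zero hm (sub_ne_zero.2 hmn))
    · have x' := ex h0
      by_cases h1 : l + m - n = 0
      · have z' := ez (by contrapose! hl; linarith)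
        refine ⟨x', fun δ p => ?_, z'⟩
        have e := T 2 1 2 (sw x' 2) δ p
        rw [structCoeff_eq hl hm hn] at e
        simp only [Fin.sum_univ_three, hd, x', z', sw x'] at e
        have s := sk δ 0 2 p
        simp at e s
        have e' : n * (n + l) * diffComp l m n S δ 0 2 p = 0 := by
          field_simp at e
          linear_combination (1 / 2) * e + (l + m + n) / 2 * s
        exact (mul_eq_zero.1 e').resolve_left
          (mul_ne_zero hn fun h => hnl (eq_neg_of_add_eq_zero_left h))
      · have y' := ey h1
        by_cases h2 : l - m + n = 0
        · refine ⟨x', y', fun δ p => ?_⟩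
          have e := T 0 2 0 (sw y' 0) δ p
          rw [structCoeff_eq hl hm hn] at e
          simp only [Fin.sum_univ_three, hd, x', y', sw y'] at e
          have s := sk δ 0 1 p
          simp at e s
          have e' : l * (m + l) * diffComp l m n S δ 1 0 p = 0 := by
            field_simp at e
            linear_combination (-1 / 2) * e + (l + m - n) / 2 * s
          exact (mul_eq_zero.1 e').resolve_left
            (mul_ne_zero hl fun h => hlm (eq_neg_of_add_eq_zero_left h).symm)
        · exact ⟨x', y', ez h2⟩
  have X := all.1
  have Y := all.2.1
  have Z := all.2.2
  fin_cases α <;> fin_cases γ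
  · exact hd δ 0 p
  · exact sw Z δ p
  · exact Y δ p
  · exact Z δ p
  · exact hd δ 1 p
  · exact sw X δ p
  · exact sw Y δ p
  · exact X δ p
  · exact hd δ 2 p

theorem eq_structTensor (hlm : -l ≠ m) (hmn : m ≠ n) (hnl : n ≠ -l) : S = structTensor l m n := by
  funext p
  ext1 u
  ext1 v
  rw [← sum_coframe_smul_frame p u, ← sum_coframe_smul_frame p v]
  simp only [map_sum, map_smul, sum_apply, smul_apply]
  refine Finset.sum_congr rfl fun β _ => ?_
  congr 1
  refine Finset.sum_congr rfl fun α _ => ?_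
  congr 1
  refine ext_coframe fun γ => ?_
  have h := comp_eval_frame l m n S α β γ p
  rw [diffComp_eq_zero hg hD hS hlm hmn hnl, add_zero] at h
  rw [structTensor_frame, coframe_sum_smul_frame]
  exact h

end

/-! ### The action of `SU(1,1)` and the invariance of the canonical connection. -/

/-- The identification of `SU(1,1)` with `ℍ³₁`, as a diffeomorphism. -/
def diffeoSU11 : SU11 ≃ₘ^∞⟮𝓘(ℝ, Model), 𝓘(ℝ, Model)⟯ H31 where
  toEquiv := mulEquivSU11.symm.toEquiv
  contMDiff_toFun := contMDiff_mulEquiv_symm.of_le le_top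
  contMDiff_invFun := contMDiff_mulEquiv.of_le le_top

theorem diffeoSU11_apply (a : SU11) : diffeoSU11 a = mulEquivSU11.symm a := rfl

theorem diffeoSU11_one : diffeoSU11 1 = 1 := map_one mulEquivSU11.symm

theorem diffeoSU11_mul (a b : SU11) : diffeoSU11 (a * b) = diffeoSU11 a * diffeoSU11 b :=
  map_mul mulEquivSU11.symm a b

theorem smul_eq (a : SU11) (p : H31) : a • p = diffeoSU11 a * p := rfl

/-- Left translations, as diffeomorphisms. -/
def diffeoMulLeft (b : H31) : H31 ≃ₘ^∞⟮𝓘(ℝ, Model), 𝓘(ℝ, Model)⟯ H31 where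
  toEquiv := Equiv.mulLeft b
  contMDiff_toFun := contMDiff_mul_left
  contMDiff_invFun := contMDiff_mul_left

theorem contMDiffSMul_SU11 : ContMDiffSMul 𝓘(ℝ, Model) 𝓘(ℝ, Model) ∞ SU11 H31 where
  contMDiff_smul := by
    have h := (contMDiff_mul 𝓘(ℝ, Model) ∞ (G := H31)).comp
      (((diffeoSU11.contMDiff).comp contMDiff_fst).prodMk contMDiff_snd :
        ContMDiff (𝓘(ℝ, Model).prod 𝓘(ℝ, Model)) (𝓘(ℝ, Model).prod 𝓘(ℝ, Model)) ∞
          (fun x : SU11 × H31 => (diffeoSU11 x.1, x.2)))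
    exact h

theorem isPretransitive_SU11 : MulAction.IsPretransitive SU11 H31 where
  exists_smul_eq p q := ⟨mulEquivSU11 (q * p⁻¹), by
    rw [smul_eq, diffeoSU11_apply, MulEquiv.symm_apply_apply, inv_mul_cancel_right]⟩

theorem faithfulSMul_SU11 : FaithfulSMul SU11 H31 where
  eq_of_smul_eq_smul h := by
    have h1 := h 1
    rw [smul_eq, smul_eq, mul_one, mul_one] at h1
    exact diffeoSU11.injective h1

theorem stabilizer_one : MulAction.stabilizer SU11 (1 : H31) = ⊥ := by
  rw [eq_bot_iff]
  intro a ha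
  have h : diffeoSU11 a * 1 = 1 := ha
  rw [mul_one, ← diffeoSU11_one] at h
  exact Subgroup.mem_bot.2 (diffeoSU11.injective h)

theorem smooth_mul_left (b : H31) :
    ContMDiff 𝓘(ℝ, Model) 𝓘(ℝ, Model) ∞ (fun q : H31 => b * q) := contMDiff_mul_left

/-- The coframe is built from `p⁻¹ q`, which equals `(bp)⁻¹ (bq)`. The free endpoint `p'` avoids
transport between tangent spaces when `b * p` simplifies, as for `q * 1`. -/
theorem coframe_mfderiv_mul_left_of_eq (γ : Fin 3) {b p p' : H31} (h : b * p = p')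
    (v : TangentSpace 𝓘(ℝ, Model) p) :
    coframe γ p' (mfderiv 𝓘(ℝ, Model) 𝓘(ℝ, Model) (fun q : H31 => b * q) p v) =
      coframe γ p v := by
  subst h
  have e : (fun q : H31 => coordFun γ (p⁻¹ * q)) =
      (fun q : H31 => coordFun γ ((b * p)⁻¹ * q)) ∘ fun q : H31 => b * q := by
    funext q
    simp [mul_assoc]
  rw [coframe, coframe, e]
  exact (mvfderiv_comp_apply p
    ((contMDiff_coordFun_mul_left γ (b * p)).mdifferentiable (by simp) _)
    ((smooth_mul_left b).mdifferentiable (by simp) p) v).symm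

theorem coframe_mfderiv_mul_left (γ : Fin 3) (b p : H31) (v : TangentSpace 𝓘(ℝ, Model) p) :
    coframe γ (b * p) (mfderiv 𝓘(ℝ, Model) 𝓘(ℝ, Model) (fun q : H31 => b * q) p v) =
      coframe γ p v := coframe_mfderiv_mul_left_of_eq γ rfl v

theorem comp_mulInvariantVectorField (γ : Fin 3) (x : GroupLieAlgebra 𝓘(ℝ, Model) H31) :
    comp γ (mulInvariantVectorField x) = fun _ => coframe γ 1 x := by
  funext q
  exact coframe_mfderiv_mul_left_of_eq γ (mul_one q) x

theorem actsByIsometries_SU11 (l m n : ℝ) : ActsByIsometries SU11 (metric l m n) := by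
  intro a p v w
  rw [metric_apply, metric_apply]
  have h := fun γ => coframe_mfderiv_mul_left γ (diffeoSU11 a) p
  refine Finset.sum_congr rfl fun γ _ => ?_
  rw [← h γ v, ← h γ w]
  rfl

theorem isInvertible_mfderiv_mul_left (b p : H31) :
    (mfderiv 𝓘(ℝ, Model) 𝓘(ℝ, Model) (fun q : H31 => b * q) p).IsInvertible :=
  ⟨(diffeoMulLeft b).mfderivToContinuousLinearEquiv (by simp) p, rfl⟩

theorem comp_mpullback_mul_left (γ : Fin 3) (b : H31) (X : VField 𝓘(ℝ, Model) H31) :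
    comp γ (VectorField.mpullback 𝓘(ℝ, Model) 𝓘(ℝ, Model) (fun q : H31 => b * q) X) =
      fun q => comp γ X (b * q) := by
  funext q
  have h := (isInvertible_mfderiv_mul_left b q).self_apply_inverse (X (b * q))
  rw [comp, comp, VectorField.mpullback_apply, ← coframe_mfderiv_mul_left γ b q, h]

/-- Pullback by a left translation composes components with that translation, and `flat`
differentiates components; the claim is then the chain rule. -/
theorem mpullback_flat (b : H31) (X : VField 𝓘(ℝ, Model) H31) {Y : VField 𝓘(ℝ, Model) H31}
    (hY : IsSmoothField 𝓘(ℝ, Model) Y) :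
    VectorField.mpullback 𝓘(ℝ, Model) 𝓘(ℝ, Model) (fun q : H31 => b * q) (flat.nabla X Y) =
      flat.nabla (VectorField.mpullback 𝓘(ℝ, Model) 𝓘(ℝ, Model) (fun q : H31 => b * q) X)
        (VectorField.mpullback 𝓘(ℝ, Model) 𝓘(ℝ, Model) (fun q : H31 => b * q) Y) := by
  refine comp_ext fun γ => ?_
  rw [comp_mpullback_mul_left, comp_flat, comp_flat, comp_mpullback_mul_left]
  funext q
  have h := (isInvertible_mfderiv_mul_left b q).self_apply_inverse (X (b * q))
  have c := mvfderiv_comp_apply q ((contMDiff_comp γ hY).mdifferentiable (by simp) (b * q))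
    ((smooth_mul_left b).mdifferentiable (by simp) q)
    (VectorField.mpullback 𝓘(ℝ, Model) 𝓘(ℝ, Model) (fun q : H31 => b * q) X q)
  rw [VectorField.mpullback_apply, h] at c
  exact c.symm

theorem isSmoothField_mpullback_mul_left (b : H31) {X : VField 𝓘(ℝ, Model) H31}
    (hX : IsSmoothField 𝓘(ℝ, Model) X) : IsSmoothField 𝓘(ℝ, Model)
      (VectorField.mpullback 𝓘(ℝ, Model) 𝓘(ℝ, Model) (fun q : H31 => b * q) X) := by
  refine isSmoothField_of_comp fun γ => ?_
  rw [comp_mpullback_mul_left]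
  exact (contMDiff_comp γ hX).comp (smooth_mul_left b)

theorem canonical_isInvariant {l m n : ℝ} (hg : ∀ α, ![l, m, n] α ≠ 0)
    {D : LinConnection 𝓘(ℝ, Model) H31} (hD : IsLeviCivita (metric l m n) D) :
    (D.canonical (structTensor l m n)).IsInvariant SU11 := by
  intro a X Y hX hY
  rw [IsLeviCivita.canonical_nabla hg hD X hY]
  exact (mpullback_flat (diffeoSU11 a) X hY).trans (IsLeviCivita.canonical_nabla hg hD _
    (isSmoothField_mpullback_mul_left (diffeoSU11 a) hY)).symm

/-! ### The Lie algebra -/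

theorem orbitDeriv_one (X : GroupLieAlgebra 𝓘(ℝ, Model) SU11) :
    orbitDeriv 𝓘(ℝ, Model) 𝓘(ℝ, Model) (1 : H31) X =
      mfderiv 𝓘(ℝ, Model) 𝓘(ℝ, Model) diffeoSU11 1 X := by
  have e : (fun a : SU11 => a • (1 : H31)) = diffeoSU11 := by
    funext a
    rw [smul_eq, mul_one]
  rw [orbitDeriv, e]
  rfl

theorem isInvertible_mfderiv_diffeoSU11 (a : SU11) :
    (mfderiv 𝓘(ℝ, Model) 𝓘(ℝ, Model) diffeoSU11 a).IsInvertible :=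
  ⟨diffeoSU11.mfderivToContinuousLinearEquiv (by simp) a, rfl⟩

theorem orbitDeriv_one_bijective : Function.Bijective
    (orbitDeriv 𝓘(ℝ, Model) 𝓘(ℝ, Model) (G := SU11) (1 : H31)) := by
  have h := (isInvertible_mfderiv_diffeoSU11 1).bijective
  have e : ⇑(orbitDeriv 𝓘(ℝ, Model) 𝓘(ℝ, Model) (G := SU11) (1 : H31)) =
      mfderiv 𝓘(ℝ, Model) 𝓘(ℝ, Model) diffeoSU11 1 := funext orbitDeriv_one
  rw [e]
  exact h

theorem isReductiveDecomposition_one : IsReductiveDecomposition 𝓘(ℝ, Model) 𝓘(ℝ, Model)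
    (G := SU11) (1 : H31) ⊥ ⊤ where
  isotropy := (LinearMap.ker_eq_bot.2 orbitDeriv_one_bijective.injective).symm
  isCompl := isCompl_bot_top
  adInvariant _ _ _ _ := Submodule.mem_top

theorem mvfderiv_comp_diffeoSU11 {f : H31 → ℝ}
    (hf : MDifferentiableAt 𝓘(ℝ, Model) 𝓘(ℝ, ℝ) f 1) (X : GroupLieAlgebra 𝓘(ℝ, Model) SU11) :
    mvfderiv 𝓘(ℝ, Model) (fun a : SU11 => f (diffeoSU11 a)) 1 X =
      mvfderiv 𝓘(ℝ, Model) f 1 (orbitDeriv 𝓘(ℝ, Model) 𝓘(ℝ, Model) (1 : H31) X) := by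
  rw [orbitDeriv_one]
  exact mvfderiv_comp_apply_of_eq 1 hf (diffeoSU11.mdifferentiable (by simp) 1) diffeoSU11_one X

/-- The homomorphism property intertwines the left translations of the two groups; differentiating
it at the neutral element relates the invariant fields. -/
theorem mpullback_mulInvariantVectorField_diffeoSU11 (X : GroupLieAlgebra 𝓘(ℝ, Model) SU11) :
    VectorField.mpullback 𝓘(ℝ, Model) 𝓘(ℝ, Model) diffeoSU11
      (mulInvariantVectorField (orbitDeriv 𝓘(ℝ, Model) 𝓘(ℝ, Model) (1 : H31) X :
        GroupLieAlgebra 𝓘(ℝ, Model) H31)) = mulInvariantVectorField X := by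
  funext a
  rw [VectorField.mpullback_apply, (isInvertible_mfderiv_diffeoSU11 a).inverse_apply_eq]
  have d := diffeoSU11.mdifferentiable (by simp)
  have e : diffeoSU11 ∘ (fun b : SU11 => a * b) = (fun q => diffeoSU11 a * q) ∘ diffeoSU11 := by
    funext b
    exact diffeoSU11_mul a b
  have h1 := mfderiv_comp_apply_of_eq (I := 𝓘(ℝ, Model)) (I' := 𝓘(ℝ, Model)) (I'' := 𝓘(ℝ, Model))
    (x := (1 : SU11)) (y := a) (f := fun b : SU11 => a * b) (g := diffeoSU11) (d a)
    ((contMDiff_mul_left (n := ∞)).mdifferentiable (by simp) 1) (mul_one a) X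
  have h2 := mfderiv_comp_apply_of_eq (I := 𝓘(ℝ, Model)) (I' := 𝓘(ℝ, Model)) (I'' := 𝓘(ℝ, Model))
    (x := (1 : SU11)) (y := (1 : H31)) (g := fun q : H31 => diffeoSU11 a * q) (f := diffeoSU11)
    ((smooth_mul_left _).mdifferentiable (by simp) 1) (d 1) diffeoSU11_one X
  rw [e] at h1
  rw [orbitDeriv_one]
  exact h2.symm.trans h1

/-- Naturality of the bracket under the diffeomorphism moves the computation to `ℍ³₁`, where
left-invariant fields have constant components and only the structure constants contribute. -/
theorem coframe_orbitDeriv_bracket (γ : Fin 3) (X Y : GroupLieAlgebra 𝓘(ℝ, Model) SU11) :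
    coframe γ 1 (orbitDeriv 𝓘(ℝ, Model) 𝓘(ℝ, Model) (1 : H31) ⁅X, Y⁆) =
      ∑ α, ∑ β, bracketCoeff α β γ *
        (coframe α 1 (orbitDeriv 𝓘(ℝ, Model) 𝓘(ℝ, Model) (1 : H31) X) *
          coframe β 1 (orbitDeriv 𝓘(ℝ, Model) 𝓘(ℝ, Model) (1 : H31) Y)) := by
  let x : GroupLieAlgebra 𝓘(ℝ, Model) H31 := orbitDeriv 𝓘(ℝ, Model) 𝓘(ℝ, Model) (1 : H31) X
  let y : GroupLieAlgebra 𝓘(ℝ, Model) H31 := orbitDeriv 𝓘(ℝ, Model) 𝓘(ℝ, Model) (1 : H31) Y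
  let B : VField 𝓘(ℝ, Model) H31 := VectorField.mlieBracket 𝓘(ℝ, Model)
    (mulInvariantVectorField x) (mulInvariantVectorField y)
  have hx := isSmoothField_mulInvariantVectorField x
  have hy := isSmoothField_mulInvariantVectorField y
  have h := VectorField.mpullback_mlieBracket (n := ∞) (hx.mdifferentiableAt (diffeoSU11 1))
    (hy.mdifferentiableAt (diffeoSU11 1)) (diffeoSU11.contMDiff 1)
    (by rw [minSmoothness_of_isRCLikeNormedField]; exact ENat.LEInfty.out)
  rw [mpullback_mulInvariantVectorField_diffeoSU11 X,
    mpullback_mulInvariantVectorField_diffeoSU11 Y, VectorField.mpullback_apply,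
    (isInvertible_mfderiv_diffeoSU11 1).inverse_apply_eq] at h
  -- The two values lie in tangent spaces at different expressions for the same point; both are
  -- compared in `Model`.
  have e : (B (diffeoSU11 1) : Model) = B 1 := congrArg (fun q => (B q : Model)) diffeoSU11_one
  have e2 : orbitDeriv 𝓘(ℝ, Model) 𝓘(ℝ, Model) (1 : H31) ⁅X, Y⁆ = B 1 :=
    (orbitDeriv_one _).trans (Eq.trans h.symm e)
  rw [e2]
  refine (comp_mlieBracket hx hy γ 1).trans ?_
  simp only [comp_mulInvariantVectorField, mvfderiv_const]
  simp [x, y]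

theorem orbitDeriv_bracket {l m n : ℝ} (hg : ∀ α, ![l, m, n] α ≠ 0)
    (X Y : GroupLieAlgebra 𝓘(ℝ, Model) SU11) :
    orbitDeriv 𝓘(ℝ, Model) 𝓘(ℝ, Model) (1 : H31) ⁅X, Y⁆ =
      structTensor l m n 1 (orbitDeriv 𝓘(ℝ, Model) 𝓘(ℝ, Model) (1 : H31) X)
        (orbitDeriv 𝓘(ℝ, Model) 𝓘(ℝ, Model) (1 : H31) Y) -
      structTensor l m n 1 (orbitDeriv 𝓘(ℝ, Model) 𝓘(ℝ, Model) (1 : H31) Y)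
        (orbitDeriv 𝓘(ℝ, Model) 𝓘(ℝ, Model) (1 : H31) X) := by
  rw [structTensor_sub hg]
  refine ext_coframe fun γ => ?_
  rw [coframe_orbitDeriv_bracket, coframe_constTensor]

/-! ### Fundamental vector fields and the adjoint representation. -/

/-- Right multiplication by `w`, as a linear map on `ℂ²`. -/
def mulRight (w : ℂ × ℂ) : ℂ × ℂ →L[ℝ] ℂ × ℂ :=
  let fs := ContinuousLinearMap.fst ℝ ℂ ℂ
  let sn := ContinuousLinearMap.snd ℝ ℂ ℂ
  (w.1 • fs + conj w.2 • sn).prod (w.2 • fs + conj w.1 • sn)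

theorem mulRight_apply (w x : ℂ × ℂ) :
    mulRight w x = (w.1 * x.1 + conj w.2 * x.2, w.2 * x.1 + conj w.1 * x.2) := rfl

theorem mulRight_incl (p q : H31) : mulRight (incl q) (incl p) = incl (p * q) := by
  rw [mulRight_apply]
  refine Prod.ext ?_ ?_ <;> simp [incl, mul_z1, mul_z2, mul_comm]

/-- The coefficients of `Ad(x⁻¹)` in the basis `X_α`. -/
def adjointCoeff (γ β : Fin 3) (x : ℂ × ℂ) : ℝ := transCoord γ x (mulRight x (frameVec β))

theorem contDiff_mulRight (e : ℂ × ℂ) : ContDiff ℝ ∞ (fun x : ℂ × ℂ => mulRight x e) := by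
  have c1 : ContDiff ℝ ∞ (fun x : ℂ × ℂ => conj x.1) := Complex.conjCLE.contDiff.comp contDiff_fst
  have c2 : ContDiff ℝ ∞ (fun x : ℂ × ℂ => conj x.2) := Complex.conjCLE.contDiff.comp contDiff_snd
  exact ((contDiff_fst.mul contDiff_const).add (c2.mul contDiff_const)).prodMk
    ((contDiff_snd.mul contDiff_const).add (c1.mul contDiff_const))

theorem contDiff_adjointCoeff (γ β : Fin 3) : ContDiff ℝ ∞ (adjointCoeff γ β) := by
  have h : ContDiff ℝ ∞ (fun x : ℂ × ℂ => (x, mulRight x (frameVec β))) :=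
    contDiff_id.prodMk (contDiff_mulRight (frameVec β))
  have h' := (contDiff_transCoord γ).comp h
  have e : adjointCoeff γ β = (fun x : (ℂ × ℂ) × (ℂ × ℂ) => transCoord γ x.1 x.2) ∘
      fun x => (x, mulRight x (frameVec β)) := by
    funext x
    rw [adjointCoeff, Function.comp_apply]
  rw [e]
  exact h'

section

variable {t : ℝ}

theorem hasDerivAt_fst {a : ℝ → ℂ × ℂ} {a' : ℂ × ℂ} (h : HasDerivAt a a' t) :
    HasDerivAt (fun s => (a s).1) a'.1 t :=
  (ContinuousLinearMap.fst ℝ ℂ ℂ).hasFDerivAt.comp_hasDerivAt t h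

theorem hasDerivAt_snd {a : ℝ → ℂ × ℂ} {a' : ℂ × ℂ} (h : HasDerivAt a a' t) :
    HasDerivAt (fun s => (a s).2) a'.2 t :=
  (ContinuousLinearMap.snd ℝ ℂ ℂ).hasFDerivAt.comp_hasDerivAt t h

theorem hasDerivAt_conj {f : ℝ → ℂ} {f' : ℂ} (h : HasDerivAt f f' t) :
    HasDerivAt (fun s => conj (f s)) (conj f') t :=
  Complex.conjCLE.hasFDerivAt.comp_hasDerivAt t h

theorem hasDerivAt_transCoord (γ : Fin 3) {a x : ℝ → ℂ × ℂ} {a' x' : ℂ × ℂ}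
    (ha : HasDerivAt a a' t) (hx : HasDerivAt x x' t) :
    HasDerivAt (fun s => transCoord γ (a s) (x s))
      (transCoord γ a' (x t) + transCoord γ (a t) x') t := by
  have a1 := hasDerivAt_fst ha
  have a2 := hasDerivAt_snd ha
  have x1 := hasDerivAt_fst hx
  have x2 := hasDerivAt_snd hx
  have im {f : ℝ → ℂ} {f' : ℂ} (h : HasDerivAt f f' t) : HasDerivAt (fun s => (f s).im) f'.im t :=
    Complex.imCLM.hasFDerivAt.comp_hasDerivAt t h
  have re {f : ℝ → ℂ} {f' : ℂ} (h : HasDerivAt f f' t) : HasDerivAt (fun s => (f s).re) f'.re t :=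
    Complex.reCLM.hasFDerivAt.comp_hasDerivAt t h
  have h0 := ((hasDerivAt_conj a1).fun_mul x1).fun_sub (a2.fun_mul (hasDerivAt_conj x2))
  have h1 := ((hasDerivAt_conj a1).fun_mul x2).fun_sub (a2.fun_mul (hasDerivAt_conj x1))
  fin_cases γ
  · refine (im h0).congr_deriv ?_
    simp [transCoord]; ring
  · refine (re h1).congr_deriv ?_
    simp [transCoord]; ring
  · refine (im h1).congr_deriv ?_
    simp [transCoord]; ring

theorem hasDerivAt_mulRight {a : ℝ → ℂ × ℂ} {a' : ℂ × ℂ} (ha : HasDerivAt a a' t)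
    (x : ℂ × ℂ) : HasDerivAt (fun s => mulRight (a s) x) (mulRight a' x) t := by
  have a1 := hasDerivAt_fst ha
  have a2 := hasDerivAt_snd ha
  exact ((a1.mul_const x.1).fun_add ((hasDerivAt_conj a2).mul_const x.2)).prodMk
    ((a2.mul_const x.1).fun_add ((hasDerivAt_conj a1).mul_const x.2))

end

/-- The two terms come from the product rule for `x⁻¹ X_β x` at the neutral element in the direction
`X_α`, namely `-X_α X_β + X_β X_α`. -/
theorem transCoord_mulRight_frameVec (α β γ : Fin 3) :
    transCoord γ (frameVec α) (mulRight (incl 1) (frameVec β)) +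
      transCoord γ (incl 1) (mulRight (frameVec α) (frameVec β)) = -bracketCoeff α β γ := by
  fin_cases α <;> fin_cases β <;> fin_cases γ <;>
    norm_num [bracketCoeff, mulRight_apply, transCoord, frameVec, incl, one_z1, one_z2]

theorem contMDiff_adjointCoeff (γ β : Fin 3) :
    ContMDiff 𝓘(ℝ, Model) 𝓘(ℝ, ℝ) ∞ (fun q : H31 => adjointCoeff γ β (incl q)) :=
  (contDiff_adjointCoeff γ β).contMDiff.comp smooth_incl

theorem mvfderiv_adjointCoeff_one (α β γ : Fin 3) :
    mvfderiv 𝓘(ℝ, Model) (fun q : H31 => adjointCoeff γ β (incl q)) 1 (frame α 1) =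
      -bracketCoeff α β γ := by
  have h := hasDerivAt_frame ((contMDiff_adjointCoeff γ β).mdifferentiable (by simp) 1) α
  have hi := hasDerivAt_incl_oneParam α
  have h' := hasDerivAt_transCoord γ hi (hasDerivAt_mulRight hi (frameVec β))
  rw [oneParam_zero, transCoord_mulRight_frameVec] at h'
  simp only [one_mul] at h
  exact h.unique h'

theorem mvfderiv_conj_frame (γ β : Fin 3) (q : H31) :
    mvfderiv 𝓘(ℝ, Model) (fun r : H31 => coordFun γ (q⁻¹ * (r * q))) 1 (frame β 1) =
      adjointCoeff γ β (incl q) := by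
  have hs : ContMDiff 𝓘(ℝ, Model) 𝓘(ℝ, ℝ) ∞ (fun r : H31 => coordFun γ (q⁻¹ * (r * q))) :=
    (contMDiff_coordFun_mul_left γ q).comp contMDiff_mul_right
  have h := hasDerivAt_frame (hs.mdifferentiable (by simp) 1) β
  refine h.unique ?_
  have h' := ((transCoord γ (incl q)).comp (mulRight (incl q))).hasFDerivAt.comp_hasDerivAt 0
    (hasDerivAt_incl_oneParam β)
  refine h'.congr_of_eventuallyEq (.of_forall fun s => ?_)
  simp [mulRight_incl, transCoord_incl]

/-- Writing `exp(sY) q = q (q⁻¹ exp(sY) q)` shows that `Y*` at `q` is the left translate of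
`Ad(q⁻¹)Y`. -/
theorem comp_fundamentalField (γ : Fin 3) (Y : GroupLieAlgebra 𝓘(ℝ, Model) SU11) (q : H31) :
    comp γ (fundamentalField 𝓘(ℝ, Model) 𝓘(ℝ, Model) Y) q =
      ∑ β, coframe β 1 (orbitDeriv 𝓘(ℝ, Model) 𝓘(ℝ, Model) (1 : H31) Y) *
        adjointCoeff γ β (incl q) := by
  have hs : ContMDiff 𝓘(ℝ, Model) 𝓘(ℝ, ℝ) ∞ (fun r : H31 => coordFun γ (q⁻¹ * (r * q))) :=
    (contMDiff_coordFun_mul_left γ q).comp contMDiff_mul_right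
  have ho : ContMDiff 𝓘(ℝ, Model) 𝓘(ℝ, Model) ∞ (fun a : SU11 => a • q) :=
    (contMDiff_mul_right (a := q)).comp diffeoSU11.contMDiff
  have h := mvfderiv_comp_apply_of_eq 1
    ((contMDiff_coordFun_mul_left γ q).mdifferentiable (by simp) q)
    (ho.mdifferentiable (by simp) 1) (one_smul SU11 q) Y
  have h2 := mvfderiv_comp_diffeoSU11 (hs.mdifferentiable (by simp) 1) Y
  rw [mvfderiv_eq_sum] at h2
  simp only [mvfderiv_conj_frame] at h2
  exact h.symm.trans h2

theorem isSmoothField_fundamentalField (Y : GroupLieAlgebra 𝓘(ℝ, Model) SU11) :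
    IsSmoothField 𝓘(ℝ, Model)
      (fundamentalField 𝓘(ℝ, Model) 𝓘(ℝ, Model) Y : VField 𝓘(ℝ, Model) H31) := by
  refine isSmoothField_of_comp fun γ => ?_
  rw [funext (comp_fundamentalField γ Y)]
  exact contMDiff_finsetSum fun β _ => contMDiff_const.mul (contMDiff_adjointCoeff γ β)

theorem coframe_flat_fundamentalField (γ : Fin 3) (X Y : GroupLieAlgebra 𝓘(ℝ, Model) SU11) :
    coframe γ 1 (flat.nabla (fundamentalField 𝓘(ℝ, Model) 𝓘(ℝ, Model) X)
      (fundamentalField 𝓘(ℝ, Model) 𝓘(ℝ, Model) Y) (1 : H31)) =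
      -coframe γ 1 (orbitDeriv 𝓘(ℝ, Model) 𝓘(ℝ, Model) (1 : H31) ⁅X, Y⁆) := by
  have d := fun β => (contMDiff_adjointCoeff γ β).mdifferentiable (by simp) 1
  have hc := fun β => mdifferentiableAt_const (I := 𝓘(ℝ, Model)) (I' := 𝓘(ℝ, ℝ)) (x := (1 : H31))
    (c := coframe β 1 (orbitDeriv 𝓘(ℝ, Model) 𝓘(ℝ, Model) (1 : H31) Y))
  have hm : ∀ β v, mvfderiv 𝓘(ℝ, Model) (fun q : H31 => adjointCoeff γ β (incl q)) 1 v =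
      ∑ α, coframe α 1 v * -bracketCoeff α β γ := fun β v => by
    simp only [← mvfderiv_adjointCoeff_one]
    exact mvfderiv_eq_sum _ 1 v
  rw [coframe_orbitDeriv_bracket]
  refine (coframe_flat γ _ 1 _).trans ?_
  rw [funext (comp_fundamentalField γ Y), mvfderiv_sum_mul hc d]
  simp only [mvfderiv_const, hm, fundamentalField]
  simp only [Fin.sum_univ_three, zero_apply]
  ring

theorem isCanonicalConnection_canonical {l m n : ℝ} (hg : ∀ α, ![l, m, n] α ≠ 0)
    {D : LinConnection 𝓘(ℝ, Model) H31} (hD : IsLeviCivita (metric l m n) D) :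
    IsCanonicalConnection 𝓘(ℝ, Model) (G := SU11) (D.canonical (structTensor l m n)) (1 : H31)
      ⊥ ⊤ where
  invariant := canonical_isInvariant hg hD
  value X _ Y _ U hU V _ h := by
    -- With trivial isotropy algebra the `𝔪`-part of the bracket is the whole bracket.
    rw [(Submodule.mem_bot ℝ).1 hU, zero_add] at h
    rw [IsLeviCivita.canonical_nabla hg hD _ (isSmoothField_fundamentalField Y), ← h]
    refine ext_coframe fun γ => ?_
    rw [coframe_flat_fundamentalField, map_neg]
    rfl

end H31

end

theorem mainTheorem6 (l m n : ℝ) (hl : l ≠ 0) (hm : 0 < m) (hn : 0 < n)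
    (hlm : -l ≠ m) (hmn : m ≠ n) (hnl : n ≠ -l) :
    IsPseudoRiemannianMetric (H31.metric l m n) ∧
    (∃ D : LinConnection 𝓘(ℝ, H31.Model) H31, IsLeviCivita (H31.metric l m n) D) ∧
    ∃ S₀ : Tensor12 𝓘(ℝ, H31.Model) H31,
      (∀ p u v w, H31.metric l m n p (S₀ p u v) w = H31.S0 l m n p u v w) ∧
      ∀ D : LinConnection 𝓘(ℝ, H31.Model) H31, IsLeviCivita (H31.metric l m n) D →
        -- `S₀` is the only homogeneous structure
        (∀ S : Tensor12 𝓘(ℝ, H31.Model) H31,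
          IsHomogeneousStructure (H31.metric l m n) D S ↔ S = S₀) ∧
        -- the left-invariant frame is parallel for `∇ - S₀`, whose curvature vanishes
        (∀ (X : VField 𝓘(ℝ, H31.Model) H31) (α : Fin 3),
          (D.canonical S₀).nabla X (H31.frame α) = 0) ∧
        (∀ X Y Z : VField 𝓘(ℝ, H31.Model) H31, IsSmoothField 𝓘(ℝ, H31.Model) X →
          IsSmoothField 𝓘(ℝ, H31.Model) Y → IsSmoothField 𝓘(ℝ, H31.Model) Z →
          (D.canonical S₀).curvature X Y Z = 0) ∧
        -- `SU(1,1)` acts smoothly, transitively, effectively and isometrically from the left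
        ContMDiffSMul 𝓘(ℝ, H31.Model) 𝓘(ℝ, H31.Model) ∞ SU11 H31 ∧
        MulAction.IsPretransitive SU11 H31 ∧
        FaithfulSMul SU11 H31 ∧
        ActsByIsometries SU11 (H31.metric l m n) ∧
        -- the reductive decomposition at `o = (1, 0)` is the trivial one, `𝔥 = 0` and `𝔪 = 𝔤`
        MulAction.stabilizer SU11 (1 : H31) = ⊥ ∧
        IsReductiveDecomposition 𝓘(ℝ, H31.Model) 𝓘(ℝ, H31.Model) (G := SU11) (1 : H31) ⊥ ⊤ ∧
        -- it induces `∇ - S₀` as its canonical connection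
        IsCanonicalConnection 𝓘(ℝ, H31.Model) (G := SU11) (D.canonical S₀) (1 : H31) ⊥ ⊤ ∧
        -- and the Lie algebra which `S₀` defines on the tangent space at `o` is that of `SU(1,1)`
        Function.Bijective
          (orbitDeriv 𝓘(ℝ, H31.Model) 𝓘(ℝ, H31.Model) (G := SU11) (1 : H31)) ∧
        ∀ X Y : GroupLieAlgebra 𝓘(ℝ, H31.Model) SU11,
          orbitDeriv 𝓘(ℝ, H31.Model) 𝓘(ℝ, H31.Model) (1 : H31) ⁅X, Y⁆ =
            S₀ 1 (orbitDeriv 𝓘(ℝ, H31.Model) 𝓘(ℝ, H31.Model) (1 : H31) X)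
              (orbitDeriv 𝓘(ℝ, H31.Model) 𝓘(ℝ, H31.Model) (1 : H31) Y) -
            S₀ 1 (orbitDeriv 𝓘(ℝ, H31.Model) 𝓘(ℝ, H31.Model) (1 : H31) Y)
              (orbitDeriv 𝓘(ℝ, H31.Model) 𝓘(ℝ, H31.Model) (1 : H31) X) := by
  have hg : ∀ α, ![l, m, n] α ≠ 0 := by
    intro α
    fin_cases α
    exacts [hl, hm.ne', hn.ne']
  refine ⟨H31.isPseudoRiemannianMetric_metric hg,
    ⟨H31.leviCivita l m n, H31.isLeviCivita_leviCivita hg⟩, H31.structTensor l m n,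
    H31.metric_structTensor hg, fun D hD => ⟨fun S => ⟨fun hS =>
      H31.eq_structTensor hg hD hS hlm hmn hnl, ?_⟩, fun X α => ?_,
      fun X Y Z hX hY hZ => H31.canonical_curvature hg hD hX hY hZ, H31.contMDiffSMul_SU11,
      H31.isPretransitive_SU11, H31.faithfulSMul_SU11, H31.actsByIsometries_SU11 l m n,
      H31.stabilizer_one, H31.isReductiveDecomposition_one,
      H31.isCanonicalConnection_canonical hg hD, H31.orbitDeriv_one_bijective,
      H31.orbitDeriv_bracket hg⟩⟩
  · rintro rfl
    exact H31.isHomogeneousStructure_structTensor hg hD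
  · rw [H31.IsLeviCivita.canonical_nabla hg hD X (H31.isSmoothField_frame α)]
    funext p
    exact DFunLike.congr_fun (H31.flat_frame α p) (X p)
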